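/- Let $G$ be a finite group, acting by conjugation on its elements and subgroups. Let $C(G)$ be the simplicial complex whose simplices are the nonempty sets of nontrivial, pairwise commuting elements of $G$, and, for a prime $p$, let $C_p(G)$ be the subcomplex of those simplices all of whose elements have order $p$. Let $A(G)$, $a_p(G)$, $s_p(G)$ and $b_p(G)$ be the posets, ordered by inclusion, of the nontrivial abelian subgroups, the nontrivial elementary abelian $p$-subgroups, the nontrivial $p$-subgroups, and the nontrivial $p$-radical subgroups of $G$ (a $p$-subgroup $P$ is $p$-radical if $N_G(P)/P$ has no nontrivial normal $p$-subgroup). Write $|\mathcal P|$ for the simplicial complex of finite nonempty chains in a poset $\mathcal P$, and put $A_p(G)=|a_p(G)|$ (Quillen's complex), $S_p(G)=|s_p(G)|$, $B_p(G)=|b_p(G)|$. $G$ acts on the geometric realizations of all these complexes. Two $G$-spaces $X,Y$ are $G$-homotopy equivalent if there is a $G$-homotopy equivalence $f:X\to Y$, that is, a continuous $G$-map for which there is a continuous $G$-map $g:Y\to X$ such that $g\circ f$ and $f\circ g$ are homotopic to the identity maps through $G$-maps. (1) $C(G)$ is $G$-homotopy equivalent to $|A(G)|$. More precisely, the map $C(G)\to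 |A(G)|$ obtained, after identifying $C(G)$ with its barycentric subdivision, from the poset map $S\mapsto\langle S\rangle$ (sending a commuting set to the subgroup it generates) is a $G$-homotopy equivalence. (2) For every prime $p$, $C_p(G)$ is $G$-homotopy equivalent to $A_p(G)$; more precisely, the map $C_p(G)\to A_p(G)$ obtained in the same way from $S\mapsto\langle S\rangle$ is a $G$-homotopy equivalence. Moreover $C_p(G)$ is $G$-homotopy equivalent to $S_p(G)$ and to $B_p(G)$. -/

import Mathlib

open scoped Pointwise

/-! ### Equivariant homotopy -/

/-- `f` commutes with the actions of `Γ`, i.e. `f` is a `Γ`-map. -/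
def IsGMap (Γ : Type*) {X Y : Type*} [SMul Γ X] [SMul Γ Y] (f : X → Y) : Prop :=
  ∀ (γ : Γ) (x : X), f (γ • x) = γ • f x

/-- `f₀` and `f₁` are `Γ`-homotopic: there is a homotopy between them through `Γ`-maps. -/
def GHomotopic (Γ : Type*) {X Y : Type*} [TopologicalSpace X] [TopologicalSpace Y]
    [SMul Γ X] [SMul Γ Y] (f₀ f₁ : C(X, Y)) : Prop :=
  ∃ H : f₀.Homotopy f₁, ∀ t : unitInterval, IsGMap Γ (fun x : X => H (t, x))

/-- `f` is a `Γ`-homotopy equivalence: a continuous `Γ`-map with an inverse, itself a continuous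
`Γ`-map, up to `Γ`-homotopy. -/
def IsGHomotopyEquiv (Γ : Type*) {X Y : Type*} [TopologicalSpace X] [TopologicalSpace Y]
    [SMul Γ X] [SMul Γ Y] (f : C(X, Y)) : Prop :=
  IsGMap Γ f ∧ ∃ g : C(Y, X), IsGMap Γ g ∧
    GHomotopic Γ (g.comp f) (ContinuousMap.id X) ∧ GHomotopic Γ (f.comp g) (ContinuousMap.id Y)

/-- `X` and `Y` are `Γ`-homotopy equivalent. -/
def GHomotopyEquivalent (Γ X Y : Type*) [TopologicalSpace X] [TopologicalSpace Y]
    [SMul Γ X] [SMul Γ Y] : Prop :=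
  ∃ f : C(X, Y), IsGHomotopyEquiv Γ f

/-! ### Geometric realization of finite simplicial complexes -/

namespace PreAbstractSimplicialComplex

/-- The geometric realization of a simplicial complex with vertices in a finite type `ι`, in
barycentric coordinates: convex combinations of vertices whose support is a face. -/
@[ext]
structure Realization {ι : Type*} [Finite ι] (K : PreAbstractSimplicialComplex ι) where
  coord : ι → ℝ
  coord_nonneg : ∀ i, 0 ≤ coord i
  sum_coord : ∑ᶠ i, coord i = 1
  support_mem : ∃ s ∈ K.faces, Function.support coord = ↑s

/-- Since there are finitely many vertices, the topology of the realization is the one induced from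
the Euclidean space of all families of coordinates. -/
instance {ι : Type*} [Finite ι] (K : PreAbstractSimplicialComplex ι) :
    TopologicalSpace K.Realization :=
  TopologicalSpace.induced Realization.coord inferInstance

/-- The action of `Γ` on the vertices is simplicial on `K`: it takes faces to faces. -/
class IsGInvariant (Γ : Type*) {ι : Type*} [Group Γ] [MulAction Γ ι]
    (K : PreAbstractSimplicialComplex ι) : Prop where
  map_mem : ∀ (γ : Γ), ∀ s ∈ K.faces, s.map (MulAction.toPerm γ).toEmbedding ∈ K.faces

/-- The action on the realization which extends the action on the vertices affinely over the
simplices. -/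
instance {Γ ι : Type*} [Finite ι] [Group Γ] [MulAction Γ ι] (K : PreAbstractSimplicialComplex ι)
    [hK : IsGInvariant Γ K] : MulAction Γ K.Realization where
  smul γ x := ⟨fun i => x.coord (γ⁻¹ • i), fun i => x.coord_nonneg _, by
    have h := finsum_comp_equiv (MulAction.toPerm γ⁻¹) (f := x.coord)
    exact h.trans x.sum_coord, by
    obtain ⟨s, hs, hx⟩ := x.support_mem
    refine ⟨_, hK.map_mem γ s hs, ?_⟩
    ext i
    have : x.coord (γ⁻¹ • i) ≠ 0 ↔ γ⁻¹ • i ∈ s := by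
      rw [← Function.mem_support, hx, Finset.mem_coe]
    simp only [Function.mem_support, this, Finset.coe_map, Set.mem_image, Finset.mem_coe]
    constructor
    · intro h
      exact ⟨_, h, by simp⟩
    · rintro ⟨j, hj, rfl⟩
      simpa using hj⟩
  one_smul x := Realization.ext (funext fun i => by
    change x.coord ((1 : Γ)⁻¹ • i) = x.coord i
    simp)
  mul_smul γ δ x := Realization.ext (funext fun i => by
    change x.coord ((γ * δ)⁻¹ • i) = x.coord (δ⁻¹ • γ⁻¹ • i)
    rw [mul_inv_rev, mul_smul])

open Classical in
/-- The map of realizations induced by a simplicial map `f`. -/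
noncomputable def Realization.map {ι κ : Type*} [Finite ι] [Finite κ]
    {K : PreAbstractSimplicialComplex ι} {L : PreAbstractSimplicialComplex κ} (f : ι → κ)
    (hf : ∀ s ∈ K.faces, s.image f ∈ L.faces) (x : K.Realization) : L.Realization :=
  ⟨fun j => ∑ᶠ i, if f i = j then x.coord i else 0,
    fun j => finsum_nonneg fun i => by
      have := x.coord_nonneg i
      split_ifs <;> simp [this], by
    have := Fintype.ofFinite ι
    have := Fintype.ofFinite κ
    have h := x.sum_coord
    simp only [finsum_eq_sum_of_fintype] at h ⊢
    rw [Finset.sum_comm]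
    simpa using h, by
    have := Fintype.ofFinite ι
    obtain ⟨s, hs, hx⟩ := x.support_mem
    refine ⟨_, hf s hs, ?_⟩
    ext j
    have hmem : ∀ i, x.coord i ≠ 0 ↔ i ∈ s := fun i => by
      rw [← Function.mem_support, hx, Finset.mem_coe]
    rw [Function.mem_support, finsum_eq_sum_of_fintype, Ne, Finset.sum_eq_zero_iff_of_nonneg]
    · simp only [Finset.mem_univ, true_implies, Finset.coe_image, Set.mem_image, Finset.mem_coe,
        ← hmem]
      push Not
      refine exists_congr fun i => ?_
      by_cases h : f i = j <;> simp [h]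
    · intro i _
      have := x.coord_nonneg i
      split_ifs <;> simp [this]⟩

/-- The simplicial realization of a subposet `P` of `α`: the simplices are the nonempty finite
chains in `P`. -/
def orderComplex {α : Type*} [PartialOrder α] (P : Set α) : PreAbstractSimplicialComplex α where
  faces := {s | s.Nonempty ∧ (∀ a ∈ s, a ∈ P) ∧ IsChain (· ≤ ·) (s : Set α)}
  isRelLowerSet_faces := fun {_} hs => ⟨hs.1, fun _ hts ht =>
    ⟨ht, fun a ha => hs.2.1 a (hts ha), hs.2.2.mono (Finset.coe_subset.2 hts)⟩⟩

/-- The barycentric subdivision of `K`: the realization of the poset of its faces, ordered by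
inclusion. -/
def subdivision {ι : Type*} (K : PreAbstractSimplicialComplex ι) :
    PreAbstractSimplicialComplex (Finset ι) :=
  orderComplex K.faces

open Classical in
/-- The canonical map from the realization of the barycentric subdivision of `K` to that of `K`:
it sends the vertex `s` to the barycenter of the face `s`, and is affine on simplices. -/
noncomputable def subdivisionMap {ι : Type*} [Finite ι] (K : PreAbstractSimplicialComplex ι)
    (y : K.subdivision.Realization) : K.Realization :=
  ⟨fun i => ∑ᶠ s : Finset ι, if i ∈ s then y.coord s / s.card else 0,
    fun i => finsum_nonneg fun s => by
      have := y.coord_nonneg s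
      split_ifs
      · positivity
      · exact le_rfl, by
    have := Fintype.ofFinite ι
    have h := y.sum_coord
    obtain ⟨c, hc, hy⟩ := y.support_mem
    simp only [finsum_eq_sum_of_fintype] at h ⊢
    rw [Finset.sum_comm]
    refine Eq.trans ?_ h
    refine Finset.sum_congr rfl fun s _ => ?_
    rw [Finset.sum_ite_mem, Finset.univ_inter, Finset.sum_const, nsmul_eq_mul]
    by_cases hs : y.coord s = 0
    · simp [hs]
    · have hsc : s ∈ c := by
        have hs' : s ∈ Function.support y.coord := hs
        rwa [hy, Finset.mem_coe] at hs'
      have hne := (K.isRelLowerSet_faces (hc.2.1 s hsc)).1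
      have : (s.card : ℝ) ≠ 0 := by simpa using hne.ne_empty
      field_simp, by
    have := Fintype.ofFinite ι
    obtain ⟨c, hc, hy⟩ := y.support_mem
    have hmem : ∀ s, y.coord s ≠ 0 ↔ s ∈ c := fun s => by
      rw [← Function.mem_support, hy, Finset.mem_coe]
    obtain ⟨m, hm, hmax⟩ := c.exists_max_image Finset.card hc.1
    have hle : ∀ s ∈ c, s ⊆ m := fun s hs => by
      rcases hc.2.2.total hs hm with h | h
      · exact h
      · exact (Finset.eq_of_subset_of_card_le h (hmax s hs)).symm.subset
    refine ⟨m, hc.2.1 m hm, ?_⟩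
    ext i
    rw [Function.mem_support, finsum_eq_sum_of_fintype, Ne, Finset.sum_eq_zero_iff_of_nonneg]
    · simp only [Finset.mem_univ, true_implies, Finset.mem_coe]
      push Not
      constructor
      · rintro ⟨s, hs⟩
        by_cases h : i ∈ s
        · refine hle s ((hmem s).1 fun h0 => hs ?_) h
          simp [h0]
        · simp [h] at hs
      · intro hi
        refine ⟨m, ?_⟩
        have h1 := (hmem m).2 hm
        have h2 : m ≠ ∅ := Finset.ne_empty_of_mem hi
        simp [hi, h1, h2]
    · intro s _
      have := y.coord_nonneg s
      split_ifs
      · positivity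
      · exact le_rfl⟩

end PreAbstractSimplicialComplex

open PreAbstractSimplicialComplex

/-! ### The commuting complexes -/

/-- The commuting complex `C(G)`: simplices are the nonempty finite sets of nontrivial, pairwise
commuting elements of `G`. -/
def commutingComplex (G : Type*) [Group G] : PreAbstractSimplicialComplex G where
  faces := {s | s.Nonempty ∧ (∀ g ∈ s, g ≠ 1) ∧ ∀ g ∈ s, ∀ h ∈ s, Commute g h}
  isRelLowerSet_faces := fun {_} hs => ⟨hs.1, fun _ hts ht =>
    ⟨ht, fun g hg => hs.2.1 g (hts hg), fun g hg h hh => hs.2.2 g (hts hg) h (hts hh)⟩⟩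

/-- The complex `C_p(G)`: the subcomplex of `C(G)` of the simplices all of whose vertices have
order `p`. -/
def commutingComplexAt (p : ℕ) (G : Type*) [Group G] : PreAbstractSimplicialComplex G where
  faces := {s | s ∈ (commutingComplex G).faces ∧ ∀ g ∈ s, orderOf g = p}
  isRelLowerSet_faces := fun {_} hs => ⟨hs.1.1, fun _ hts ht =>
    ⟨((commutingComplex G).isRelLowerSet_faces hs.1).2 hts ht, fun g hg => hs.2 g (hts hg)⟩⟩

instance (G : Type*) [Group G] : IsGInvariant (ConjAct G) (commutingComplex G) where
  map_mem γ s hs := by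
    refine ⟨hs.1.map, ?_, ?_⟩
    · intro g hg
      obtain ⟨k, hk, rfl⟩ := Finset.mem_map.1 hg
      exact fun h => hs.2.1 k hk ((MulDistribMulAction.toMulEquiv G γ).map_eq_one_iff.1 h)
    · intro g hg h hh
      obtain ⟨k, hk, rfl⟩ := Finset.mem_map.1 hg
      obtain ⟨l, hl, rfl⟩ := Finset.mem_map.1 hh
      simpa using (hs.2.2 k hk l hl).map (MulDistribMulAction.toMonoidHom G γ)

instance (p : ℕ) (G : Type*) [Group G] : IsGInvariant (ConjAct G) (commutingComplexAt p G) where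
  map_mem γ s hs := by
    refine ⟨IsGInvariant.map_mem γ s hs.1, ?_⟩
    intro g hg
    obtain ⟨k, hk, rfl⟩ := Finset.mem_map.1 hg
    rw [← hs.2 k hk]
    exact (MulDistribMulAction.toMulEquiv G γ).orderOf_eq k

/-! ### The posets of subgroups -/

/-- The poset `A(G)` of nontrivial abelian subgroups. -/
def abelianSubgroups (G : Type*) [Group G] : Set (Subgroup G) :=
  {H | H ≠ ⊥ ∧ IsMulCommutative H}

/-- The poset of nontrivial elementary abelian `p`-subgroups. -/
def elementaryAbelianSubgroups (p : ℕ) (G : Type*) [Group G] : Set (Subgroup G) :=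
  {H | H ≠ ⊥ ∧ IsMulCommutative H ∧ ∀ h ∈ H, h ^ p = 1}

/-- The poset of nontrivial `p`-subgroups. -/
def nontrivialPSubgroups (p : ℕ) (G : Type*) [Group G] : Set (Subgroup G) :=
  {H | H ≠ ⊥ ∧ IsPGroup p H}

/-- The poset of nontrivial `p`-radical subgroups: nontrivial `p`-subgroups `P` such that
`N_G(P) / P` has no nontrivial normal `p`-subgroup. -/
def radicalPSubgroups (p : ℕ) (G : Type*) [Group G] : Set (Subgroup G) :=
  {P | P ≠ ⊥ ∧ IsPGroup p P ∧
    ∀ Q : Subgroup (Subgroup.normalizer (P : Set G) ⧸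
      P.subgroupOf (Subgroup.normalizer (P : Set G))), Q.Normal → IsPGroup p Q → Q = ⊥}

section invariance

variable {G : Type*} [Group G]

theorem isGInvariant_orderComplex {P : Set (Subgroup G)}
    (hP : ∀ (γ : ConjAct G), ∀ H ∈ P, γ • H ∈ P) : IsGInvariant (ConjAct G) (orderComplex P) where
  map_mem γ s hs := by
    refine ⟨hs.1.map, ?_, ?_⟩
    · intro H hH
      obtain ⟨K, hK, rfl⟩ := Finset.mem_map.1 hH
      exact hP γ K (hs.2.1 K hK)
    · rw [Finset.coe_map]
      refine hs.2.2.image_of_map_rel (· ≤ ·) (· ≤ ·) _ ?_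
      intro H K h
      exact Subgroup.pointwise_smul_le_pointwise_smul_iff.2 h

theorem conj_smul_ne_bot (γ : ConjAct G) {H : Subgroup G} (hH : H ≠ ⊥) : γ • H ≠ ⊥ := by
  intro h
  apply hH
  have := congrArg (fun K => γ⁻¹ • K) h
  simpa using this

theorem conj_smul_isMulCommutative (γ : ConjAct G) {H : Subgroup G} (hH : IsMulCommutative H) :
    IsMulCommutative (γ • H : Subgroup G) := by
  refine ⟨⟨?_⟩⟩
  rintro ⟨_, a, ha, rfl⟩ ⟨_, b, hb, rfl⟩
  have := congrArg Subtype.val (hH.is_comm.comm ⟨a, ha⟩ ⟨b, hb⟩)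
  apply Subtype.ext
  simpa using congrArg (fun x => γ • x) this

theorem conj_smul_isPGroup {p : ℕ} (γ : ConjAct G) {H : Subgroup G} (hH : IsPGroup p H) :
    IsPGroup p (γ • H : Subgroup G) :=
  hH.of_equiv (Subgroup.equivSMul γ H)

theorem conj_smul_mem_radicalPSubgroups {p : ℕ} (γ : ConjAct G) {P : Subgroup G}
    (hP : P ∈ radicalPSubgroups p G) : γ • P ∈ radicalPSubgroups p G := by
  refine ⟨conj_smul_ne_bot γ hP.1, conj_smul_isPGroup γ hP.2.1, ?_⟩
  have hN : (Subgroup.normalizer (P : Set G)).map (MulDistribMulAction.toMulEquiv G γ).toMonoidHom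
      = Subgroup.normalizer ((γ • P : Subgroup G) : Set G) :=
    Subgroup.map_equiv_normalizer_eq P (MulDistribMulAction.toMulEquiv G γ)
  let e : Subgroup.normalizer (P : Set G) ≃* Subgroup.normalizer ((γ • P : Subgroup G) : Set G) :=
    ((MulDistribMulAction.toMulEquiv G γ).subgroupMap _).trans (MulEquiv.subgroupCongr hN)
  have he : ∀ x, ((e x : Subgroup.normalizer ((γ • P : Subgroup G) : Set G)) : G) = γ • (x : G) :=
    fun x => rfl
  let E := QuotientGroup.congr (P.subgroupOf (Subgroup.normalizer (P : Set G)))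
    ((γ • P).subgroupOf (Subgroup.normalizer ((γ • P : Subgroup G) : Set G))) e (by
      ext y
      obtain ⟨x, rfl⟩ := e.surjective y
      rw [Subgroup.mem_subgroupOf, he, Subgroup.smul_mem_pointwise_smul_iff]
      constructor
      · rintro ⟨z, hz, hzx⟩
        rw [← e.injective hzx]
        exact hz
      · exact fun hx => ⟨x, hx, rfl⟩)
  intro Q hQ hQp
  have h := hP.2.2 (Q.comap E.toMonoidHom) (hQ.comap _)
    (hQp.comap_of_injective E.toMonoidHom E.injective)
  rw [eq_bot_iff]
  intro y hy
  obtain ⟨x, rfl⟩ := E.surjective y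
  have hx : x ∈ Q.comap E.toMonoidHom := hy
  rw [h, Subgroup.mem_bot] at hx
  rw [hx, map_one]
  exact Subgroup.one_mem _

end invariance

/-- The realization of the poset `A(G)`. -/
def abelianComplex (G : Type*) [Group G] : PreAbstractSimplicialComplex (Subgroup G) :=
  orderComplex (abelianSubgroups G)

/-- The Quillen complex `A_p(G)`. -/
def quillenComplex (p : ℕ) (G : Type*) [Group G] : PreAbstractSimplicialComplex (Subgroup G) :=
  orderComplex (elementaryAbelianSubgroups p G)

/-- The Brown complex `S_p(G)`. -/
def brownComplex (p : ℕ) (G : Type*) [Group G] : PreAbstractSimplicialComplex (Subgroup G) :=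
  orderComplex (nontrivialPSubgroups p G)

/-- The complex `B_p(G)` of `p`-radical subgroups. -/
def radicalComplex (p : ℕ) (G : Type*) [Group G] : PreAbstractSimplicialComplex (Subgroup G) :=
  orderComplex (radicalPSubgroups p G)

instance (G : Type*) [Group G] : IsGInvariant (ConjAct G) (abelianComplex G) :=
  isGInvariant_orderComplex fun γ _ hH =>
    ⟨conj_smul_ne_bot γ hH.1, conj_smul_isMulCommutative γ hH.2⟩

instance (p : ℕ) (G : Type*) [Group G] : IsGInvariant (ConjAct G) (quillenComplex p G) :=
  isGInvariant_orderComplex fun γ _ hH =>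
    ⟨conj_smul_ne_bot γ hH.1, conj_smul_isMulCommutative γ hH.2.1, by
      rintro _ ⟨a, ha, rfl⟩
      simpa using congrArg (fun x => γ • x) (hH.2.2 a ha)⟩

instance (p : ℕ) (G : Type*) [Group G] : IsGInvariant (ConjAct G) (brownComplex p G) :=
  isGInvariant_orderComplex fun γ _ hH =>
    ⟨conj_smul_ne_bot γ hH.1, conj_smul_isPGroup γ hH.2⟩

instance (p : ℕ) (G : Type*) [Group G] : IsGInvariant (ConjAct G) (radicalComplex p G) :=
  isGInvariant_orderComplex fun γ _ hH => conj_smul_mem_radicalPSubgroups γ hH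

/-! ### The map sending a commuting set to the subgroup it generates -/

section retraction

variable {G : Type*} [Group G]

theorem closure_mem_abelianSubgroups {s : Finset G} (hs : s ∈ (commutingComplex G).faces) :
    Subgroup.closure (s : Set G) ∈ abelianSubgroups G := by
  obtain ⟨⟨g, hg⟩, h1, hc⟩ := hs
  refine ⟨fun h => h1 g hg ?_, Subgroup.isMulCommutative_closure fun a ha b hb => hc a ha b hb⟩
  rw [← Subgroup.mem_bot, ← h]
  exact Subgroup.subset_closure hg

theorem closure_mem_elementaryAbelianSubgroups {p : ℕ} {s : Finset G}
    (hs : s ∈ (commutingComplexAt p G).faces) :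
    Subgroup.closure (s : Set G) ∈ elementaryAbelianSubgroups p G := by
  have h := closure_mem_abelianSubgroups hs.1
  refine ⟨h.1, h.2, fun x hx => ?_⟩
  induction hx using Subgroup.closure_induction with
  | mem x hx => rw [← hs.2 x hx, pow_orderOf_eq_one]
  | one => simp
  | mul x y hx hy hx' hy' =>
    have hxy : Commute x y := congrArg Subtype.val (h.2.is_comm.comm ⟨x, hx⟩ ⟨y, hy⟩)
    rw [hxy.mul_pow, hx', hy', one_mul]
  | inv x _ hx' => rw [inv_pow, hx', inv_one]

open Classical in
theorem image_closure_mem_orderComplex {F : Set (Finset G)} {P : Set (Subgroup G)}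
    (h : ∀ s ∈ F, Subgroup.closure (s : Set G) ∈ P) :
    ∀ c ∈ (orderComplex F).faces,
      c.image (fun s : Finset G => Subgroup.closure (s : Set G)) ∈ (orderComplex P).faces := by
  intro c hc
  refine ⟨hc.1.image _, ?_, ?_⟩
  · intro H hH
    obtain ⟨s, hs, rfl⟩ := Finset.mem_image.1 hH
    exact h s (hc.2.1 s hs)
  · rw [Finset.coe_image]
    refine hc.2.2.image_of_map_rel (· ≤ ·) (· ≤ ·) _ ?_
    intro s t hst
    exact Subgroup.closure_mono (Finset.coe_subset.2 hst)

/-- The map from the barycentric subdivision of `C(G)` to the realization of `A(G)` induced by the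
poset map `S ↦ ⟨S⟩`. -/
noncomputable def generatedSubgroupMap (G : Type*) [Group G] [Finite G] :
    (commutingComplex G).subdivision.Realization → (abelianComplex G).Realization :=
  Realization.map (fun s : Finset G => Subgroup.closure (s : Set G))
    (image_closure_mem_orderComplex fun _ hs => closure_mem_abelianSubgroups hs)

/-- The map from the barycentric subdivision of `C_p(G)` to `A_p(G)` induced by the poset map
`S ↦ ⟨S⟩`. -/
noncomputable def generatedSubgroupMapAt (p : ℕ) (G : Type*) [Group G] [Finite G] :
    (commutingComplexAt p G).subdivision.Realization → (quillenComplex p G).Realization :=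
  Realization.map (fun s : Finset G => Subgroup.closure (s : Set G))
    (image_closure_mem_orderComplex fun _ hs => closure_mem_elementaryAbelianSubgroups hs)

end retraction

/-! ### Equivariant homotopies -/

theorem IsGMap.comp {Γ X Y Z : Type*} [SMul Γ X] [SMul Γ Y] [SMul Γ Z] {g : Y → Z} {f : X → Y}
    (hg : IsGMap Γ g) (hf : IsGMap Γ f) : IsGMap Γ (g ∘ f) :=
  fun γ x => by simp [hf γ x, hg γ (f x)]

section GHomotopy

variable {Γ X Y Z : Type*} [TopologicalSpace X] [TopologicalSpace Y] [TopologicalSpace Z]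
  [SMul Γ X] [SMul Γ Y] [SMul Γ Z]

theorem GHomotopic.refl {f : C(X, Y)} (hf : IsGMap Γ f) : GHomotopic Γ f f :=
  ⟨ContinuousMap.Homotopy.refl f, fun _ γ x => by simpa using hf γ x⟩

theorem GHomotopic.symm {f g : C(X, Y)} : GHomotopic Γ f g → GHomotopic Γ g f := by
  rintro ⟨H, hH⟩
  exact ⟨H.symm, fun t γ x => by simpa using hH (unitInterval.symm t) γ x⟩

theorem GHomotopic.trans {f g h : C(X, Y)} :
    GHomotopic Γ f g → GHomotopic Γ g h → GHomotopic Γ f h := by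
  rintro ⟨H, hH⟩ ⟨K, hK⟩
  refine ⟨H.trans K, fun t γ x => ?_⟩
  simp only [ContinuousMap.Homotopy.trans_apply]
  split_ifs
  · exact hH _ γ x
  · exact hK _ γ x

theorem GHomotopic.postcomp {f g : C(X, Y)} (h : GHomotopic Γ f g) {k : C(Y, Z)}
    (hk : IsGMap Γ k) : GHomotopic Γ (k.comp f) (k.comp g) := by
  obtain ⟨H, hH⟩ := h
  refine ⟨(ContinuousMap.Homotopy.refl k).comp H, fun t γ x => ?_⟩
  have := hH t γ x
  simp only [ContinuousMap.Homotopy.comp_apply, ContinuousMap.Homotopy.refl_apply] at this ⊢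
  rw [this, hk]

theorem GHomotopic.precomp {f g : C(Y, Z)} (h : GHomotopic Γ f g) {k : C(X, Y)}
    (hk : IsGMap Γ k) : GHomotopic Γ (f.comp k) (g.comp k) := by
  obtain ⟨H, hH⟩ := h
  refine ⟨H.comp (ContinuousMap.Homotopy.refl k), fun t γ x => ?_⟩
  have := hH t γ (k x)
  simp only [ContinuousMap.Homotopy.comp_apply, ContinuousMap.Homotopy.refl_apply] at this ⊢
  rw [hk, this]

theorem GHomotopyEquivalent.refl : GHomotopyEquivalent Γ X X :=
  have hid : IsGMap Γ (ContinuousMap.id X) := fun _ _ => rfl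
  ⟨ContinuousMap.id X, hid, ContinuousMap.id X, hid, .refl hid, .refl hid⟩

theorem GHomotopyEquivalent.symm : GHomotopyEquivalent Γ X Y → GHomotopyEquivalent Γ Y X := by
  rintro ⟨f, hf, g, hg, h₁, h₂⟩
  exact ⟨g, hg, f, hf, h₂, h₁⟩

theorem GHomotopyEquivalent.trans :
    GHomotopyEquivalent Γ X Y → GHomotopyEquivalent Γ Y Z → GHomotopyEquivalent Γ X Z := by
  rintro ⟨f, hf, g, hg, h₁, h₂⟩ ⟨f', hf', g', hg', h₁', h₂'⟩
  refine ⟨f'.comp f, hf'.comp hf, g.comp g', hg.comp hg', ?_, ?_⟩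
  · exact ((h₁'.precomp hf).postcomp hg).trans h₁
  · exact ((h₂.precomp hg').postcomp hf').trans h₂'

end GHomotopy

namespace PreAbstractSimplicialComplex

/-! ### Topology of the realization -/

/-- Points of the realization are the convex combinations supported inside some face. -/
theorem exists_support_eq {ι : Type*} {K : PreAbstractSimplicialComplex ι} {c : ι → ℝ}
    {s : Finset ι} (hs : s ∈ K.faces) (hsum : ∑ᶠ i, c i = 1) (hc : ∀ i, c i ≠ 0 → i ∈ s) :
    ∃ t ∈ K.faces, Function.support c = ↑t := by
  classical
  have hsub : Function.support c ⊆ s := hc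
  have hfin := s.finite_toSet.subset hsub
  refine ⟨hfin.toFinset, (K.isRelLowerSet_faces hs).2 ?_ ?_, by simp⟩
  · intro i hi
    exact hc i (by simpa using hi)
  · rw [hfin.toFinset_nonempty]
    by_contra h
    rw [Set.not_nonempty_iff_eq_empty, Function.support_eq_empty_iff] at h
    simp [h] at hsum

section Topology

variable {ι κ : Type*} [Finite ι] [Finite κ]
  {K : PreAbstractSimplicialComplex ι} {L : PreAbstractSimplicialComplex κ}

theorem Realization.coord_injective : Function.Injective (Realization.coord (K := K)) :=
  fun _ _ h => Realization.ext h

theorem Realization.continuous_coord (i : ι) :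
    Continuous fun x : K.Realization => x.coord i :=
  (continuous_apply i).comp continuous_induced_dom

theorem Realization.continuous_of_coord {X : Type*} [TopologicalSpace X] {f : X → K.Realization}
    (h : ∀ i, Continuous fun x => (f x).coord i) : Continuous f :=
  continuous_induced_rng.2 (continuous_pi h)

theorem Realization.isClosedEmbedding_coord :
    Topology.IsClosedEmbedding (Realization.coord (K := K)) := by
  have := Fintype.ofFinite ι
  refine ⟨⟨⟨rfl⟩, coord_injective⟩, ?_⟩
  have : Set.range (Realization.coord (K := K)) =
      ⋃ s ∈ K.faces, {c : ι → ℝ | (∀ i, 0 ≤ c i) ∧ ∑ i, c i = 1 ∧ ∀ i, i ∉ s → c i = 0} := by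
    ext c
    simp only [Set.mem_range, Set.mem_iUnion, Set.mem_ofPred_eq, exists_prop]
    constructor
    · rintro ⟨x, rfl⟩
      obtain ⟨s, hs, hx⟩ := x.support_mem
      refine ⟨s, hs, x.coord_nonneg, by simpa [finsum_eq_sum_of_fintype] using x.sum_coord,
        fun i hi => ?_⟩
      by_contra h
      exact hi (by simpa [hx] using (show i ∈ Function.support x.coord from h))
    · rintro ⟨s, hs, h0, h1, hsupp⟩
      rw [← finsum_eq_sum_of_fintype] at h1
      exact ⟨⟨c, h0, h1, exists_support_eq hs h1 fun i hi => by_contra fun h => hi (hsupp i h)⟩,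
        rfl⟩
  rw [this]
  refine Set.Finite.isClosed_biUnion (Set.toFinite _) fun s _ => ?_
  simp only [Set.ofPred_and, Set.ofPred_forall]
  refine IsClosed.inter ?_ (IsClosed.inter ?_ ?_)
  · exact isClosed_iInter fun i => isClosed_le continuous_const (continuous_apply i)
  · exact isClosed_eq (continuous_finsetSum _ fun i _ => continuous_apply i) continuous_const
  · exact isClosed_iInter fun i => isClosed_iInter fun _ =>
      isClosed_eq (continuous_apply i) continuous_const

instance : T2Space K.Realization :=
  Realization.isClosedEmbedding_coord.isEmbedding.t2Space

theorem Realization.coord_le_one (x : K.Realization) (i : ι) : x.coord i ≤ 1 := by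
  have := Fintype.ofFinite ι
  rw [← x.sum_coord, finsum_eq_sum_of_fintype]
  exact Finset.single_le_sum (fun j _ => x.coord_nonneg j) (Finset.mem_univ i)

instance : CompactSpace K.Realization := by
  rw [← isCompact_univ_iff,
    Realization.isClosedEmbedding_coord.isInducing.isCompact_iff, Set.image_univ]
  refine (isCompact_univ_pi fun _ : ι => isCompact_Icc (a := (0 : ℝ)) (b := 1)).of_isClosed_subset
    Realization.isClosedEmbedding_coord.isClosed_range ?_
  rintro _ ⟨x, rfl⟩ i _
  exact ⟨x.coord_nonneg i, x.coord_le_one i⟩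

end Topology

/-! ### Contiguous maps -/

section Contiguous

variable {ι : Type*} [Finite ι] {K : PreAbstractSimplicialComplex ι}

/-- Two maps into a realization are contiguous if their values always lie in a common simplex. -/
def Contiguous {X : Type*} (f g : X → K.Realization) : Prop :=
  ∀ x, ∃ s ∈ K.faces, ∀ i, (f x).coord i ≠ 0 ∨ (g x).coord i ≠ 0 → i ∈ s

/-- The point dividing the segment between two points of a common simplex in the ratio
`t : 1 - t`. -/
noncomputable def Realization.lineMap (x y : K.Realization)
    (h : ∃ s ∈ K.faces, ∀ i, x.coord i ≠ 0 ∨ y.coord i ≠ 0 → i ∈ s) (t : unitInterval) :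
    K.Realization :=
  have hsum : ∑ᶠ i, ((1 - (t : ℝ)) * x.coord i + t * y.coord i) = 1 := by
    have := Fintype.ofFinite ι
    have hx := x.sum_coord
    have hy := y.sum_coord
    rw [finsum_eq_sum_of_fintype] at hx hy ⊢
    rw [Finset.sum_add_distrib, ← Finset.mul_sum, ← Finset.mul_sum, hx, hy]
    ring
  ⟨fun i => (1 - (t : ℝ)) * x.coord i + t * y.coord i,
    fun i => add_nonneg (mul_nonneg (sub_nonneg.2 t.2.2) (x.coord_nonneg i))
      (mul_nonneg t.2.1 (y.coord_nonneg i)),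
    hsum, by
      obtain ⟨s, hs, hi⟩ := h
      refine exists_support_eq hs hsum fun i h0 => hi i ?_
      by_contra! h
      simp [h.1, h.2] at h0⟩

theorem Contiguous.gHomotopic {Γ X : Type*} [Group Γ] [MulAction Γ ι] [IsGInvariant Γ K]
    [TopologicalSpace X] [SMul Γ X] {f g : C(X, K.Realization)} (h : Contiguous f g)
    (hf : IsGMap Γ f) (hg : IsGMap Γ g) : GHomotopic Γ f g := by
  refine ⟨⟨⟨fun q => Realization.lineMap (f q.2) (g q.2) (h q.2) q.1, ?_⟩, ?_, ?_⟩, ?_⟩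
  · refine Realization.continuous_of_coord fun i => ?_
    have h1 := (Realization.continuous_coord (K := K) i).comp (f.continuous.comp
      (continuous_snd (X := unitInterval)))
    have h2 := (Realization.continuous_coord (K := K) i).comp (g.continuous.comp
      (continuous_snd (X := unitInterval)))
    have h3 : Continuous fun q : unitInterval × X => (q.1 : ℝ) :=
      continuous_subtype_val.comp continuous_fst
    exact ((continuous_const.sub h3).mul h1).add (h3.mul h2)
  · intro x
    exact Realization.ext (funext fun i => by simp [Realization.lineMap])
  · intro x
    exact Realization.ext (funext fun i => by simp [Realization.lineMap])
  · intro t γ x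
    refine Realization.ext (funext fun i => ?_)
    change (1 - (t : ℝ)) * (f (γ • x)).coord i + t * (g (γ • x)).coord i =
      (1 - (t : ℝ)) * (f x).coord (γ⁻¹ • i) + t * (g x).coord (γ⁻¹ • i)
    rw [hf, hg]
    rfl

end Contiguous

/-! ### Simplicial maps -/

section IsSimplicial

open scoped Classical

variable {ι κ μ : Type*} {K : PreAbstractSimplicialComplex ι} {L : PreAbstractSimplicialComplex κ}
  {N : PreAbstractSimplicialComplex μ}

/-- `f` maps faces of `K` to faces of `L`. -/
def IsSimplicial (K : PreAbstractSimplicialComplex ι) (L : PreAbstractSimplicialComplex κ)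
    (f : ι → κ) : Prop :=
  ∀ s ∈ K.faces, s.image f ∈ L.faces

theorem IsSimplicial.comp {g : κ → μ} {f : ι → κ} (hg : IsSimplicial L N g)
    (hf : IsSimplicial K L f) : IsSimplicial K N (g ∘ f) := fun s hs => by
  rw [← Finset.image_image]
  exact hg _ (hf s hs)

theorem isSimplicial_id : IsSimplicial K K id := fun s hs => by simpa using hs

end IsSimplicial

section Map

open scoped Classical

variable {ι κ μ : Type*} [Finite ι] [Finite κ] [Finite μ]
  {K : PreAbstractSimplicialComplex ι} {L : PreAbstractSimplicialComplex κ}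
  {N : PreAbstractSimplicialComplex μ}

theorem Realization.map_coord (f : ι → κ) (hf : IsSimplicial K L f) (x : K.Realization) (j : κ) :
    (Realization.map f hf x).coord j = ∑ᶠ i, if f i = j then x.coord i else 0 := rfl

/-- The map of realizations induced by a simplicial map, as a continuous map. -/
noncomputable def realizationMap (f : ι → κ) (hf : IsSimplicial K L f) :
    C(K.Realization, L.Realization) where
  toFun := Realization.map f hf
  continuous_toFun := by
    have := Fintype.ofFinite ι
    refine Realization.continuous_of_coord fun j => ?_
    simp only [Realization.map_coord, finsum_eq_sum_of_fintype]
    refine continuous_finsetSum _ fun i _ => ?_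
    split_ifs
    · exact Realization.continuous_coord i
    · exact continuous_const

theorem realizationMap_coord (f : ι → κ) (hf : IsSimplicial K L f) (x : K.Realization) (j : κ) :
    (realizationMap f hf x).coord j = ∑ᶠ i, if f i = j then x.coord i else 0 := rfl

theorem exists_of_realizationMap_coord_ne_zero {f : ι → κ} {hf : IsSimplicial K L f}
    {x : K.Realization} {j : κ} (h : (realizationMap f hf x).coord j ≠ 0) :
    ∃ i, x.coord i ≠ 0 ∧ f i = j := by
  rw [realizationMap_coord] at h
  contrapose! h
  refine (finsum_congr fun i => ?_).trans finsum_zero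
  split_ifs with hi
  · by_contra h0
    exact h i h0 hi
  · rfl

theorem mem_vertices_of_coord_ne_zero {x : K.Realization} {i : ι} (h : x.coord i ≠ 0) :
    ∃ s ∈ K.faces, i ∈ s := by
  obtain ⟨s, hs, hx⟩ := x.support_mem
  exact ⟨s, hs, by simpa [hx] using (show i ∈ Function.support x.coord from h)⟩

theorem realizationMap_congr {f g : ι → κ} (hf : IsSimplicial K L f) (hg : IsSimplicial K L g)
    (h : ∀ s ∈ K.faces, ∀ i ∈ s, f i = g i) : realizationMap f hf = realizationMap g hg := by
  ext x j
  rw [realizationMap_coord, realizationMap_coord]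
  refine finsum_congr fun i => ?_
  by_cases hi : x.coord i = 0
  · simp [hi]
  · obtain ⟨s, hs, his⟩ := mem_vertices_of_coord_ne_zero hi
    rw [h s hs i his]

theorem realizationMap_comp {g : κ → μ} {f : ι → κ} (hg : IsSimplicial L N g)
    (hf : IsSimplicial K L f) :
    (realizationMap g hg).comp (realizationMap f hf) = realizationMap (g ∘ f) (hg.comp hf) := by
  have := Fintype.ofFinite ι
  have := Fintype.ofFinite κ
  ext x k
  rw [ContinuousMap.comp_apply]
  simp only [realizationMap_coord, finsum_eq_sum_of_fintype, Function.comp_apply]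
  have : ∀ j : κ, (if g j = k then ∑ i, (if f i = j then x.coord i else 0) else 0) =
      ∑ i, if f i = j then (if g (f i) = k then x.coord i else 0) else 0 := fun j => by
    split_ifs with h
    · refine Finset.sum_congr rfl fun i _ => ?_
      by_cases hi : f i = j
      · simp [hi, h]
      · simp [hi]
    · refine (Finset.sum_eq_zero fun i _ => ?_).symm
      by_cases hi : f i = j
      · simp [hi, h]
      · simp [hi]
  simp_rw [this]
  rw [Finset.sum_comm]
  simp

theorem realizationMap_id : realizationMap id (isSimplicial_id (K := K)) = ContinuousMap.id _ := by
  ext x k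
  rw [realizationMap_coord]
  have := Fintype.ofFinite ι
  simp [finsum_eq_sum_of_fintype]

variable {Γ : Type*} [Group Γ] [MulAction Γ ι] [MulAction Γ κ] [IsGInvariant Γ K]
  [IsGInvariant Γ L]

theorem isGMap_realizationMap {f : ι → κ} (hf : IsSimplicial K L f)
    (h : ∀ s ∈ K.faces, ∀ i ∈ s, ∀ γ : Γ, f (γ • i) = γ • f i) :
    IsGMap Γ (realizationMap f hf) := by
  intro γ x
  refine Realization.ext (funext fun j => ?_)
  change _ = (realizationMap f hf x).coord (γ⁻¹ • j)
  rw [realizationMap_coord, realizationMap_coord, ← finsum_comp_equiv (MulAction.toPerm γ)]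
  refine finsum_congr fun i => ?_
  change (if f (γ • i) = j then x.coord (γ⁻¹ • γ • i) else 0) = _
  rw [inv_smul_smul]
  by_cases hi : x.coord i = 0
  · simp [hi]
  · obtain ⟨s, hs, his⟩ := mem_vertices_of_coord_ne_zero hi
    rw [h s hs i his]
    simp only [eq_inv_smul_iff]

end Map

/-! ### Barycentric subdivision -/

open scoped Classical in
theorem smul_mem_faces {Γ ι : Type*} [Group Γ] [MulAction Γ ι] {K : PreAbstractSimplicialComplex ι}
    [hK : IsGInvariant Γ K] (γ : Γ) {s : Finset ι} (hs : s ∈ K.faces) :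
    γ • s ∈ K.faces := by
  have := hK.map_mem γ s hs
  rw [Finset.map_eq_image] at this
  exact this

section Subdivision

open scoped Classical
open MeasureTheory

variable {ι : Type*} [Finite ι] {K : PreAbstractSimplicialComplex ι}

theorem subdivisionMap_coord [Fintype ι] (y : K.subdivision.Realization) (i : ι) :
    (K.subdivisionMap y).coord i = ∑ s : Finset ι, if i ∈ s then y.coord s / s.card else 0 :=
  finsum_eq_sum_of_fintype _

theorem continuous_subdivisionMap : Continuous K.subdivisionMap := by
  have := Fintype.ofFinite ι
  refine Realization.continuous_of_coord fun i => ?_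
  simp only [subdivisionMap_coord]
  refine continuous_finsetSum _ fun s _ => ?_
  split_ifs
  · exact (Realization.continuous_coord s).div_const _
  · exact continuous_const

/-- The levels `t` at which `s` is the strict superlevel set of `c`. -/
def levels (c : ι → ℝ) (s : Finset ι) : Set ℝ := {t | ∀ i, i ∈ s ↔ t < c i}

theorem measurableSet_levels (c : ι → ℝ) (s : Finset ι) : MeasurableSet (levels c s) := by
  have : levels c s = ⋂ i, {t | i ∈ s ↔ t < c i} := by ext; simp [levels]
  rw [this]
  refine MeasurableSet.iInter fun i => ?_
  by_cases hi : i ∈ s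
  · simp only [hi, true_iff]
    exact measurableSet_Iio (a := c i)
  · simp only [hi, false_iff, not_lt]
    exact measurableSet_Ici (a := c i)

/-- The measure of the set of levels in `[0, 1)` at which `s` is the superlevel set of `c`. -/
noncomputable def levelWeight (c : ι → ℝ) (s : Finset ι) : ℝ :=
  (volume.restrict (Set.Ico (0 : ℝ) 1)).real (levels c s)

theorem levelWeight_nonneg {ι : Type*} (c : ι → ℝ) (s : Finset ι) : 0 ≤ levelWeight c s :=
  measureReal_nonneg

theorem exists_mem_levels {c : ι → ℝ} {s : Finset ι} (h : levelWeight c s ≠ 0) :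
    ∃ t, 0 ≤ t ∧ t ∈ levels c s := by
  by_contra! hne
  apply h
  rw [levelWeight, measureReal_restrict_apply (measurableSet_levels c s)]
  have : levels c s ∩ Set.Ico 0 1 = ∅ := by
    ext t
    simp only [Set.mem_inter_iff, Set.mem_Ico, Set.mem_empty_iff_false, iff_false]
    exact fun ht => hne t ht.2.1 ht.1
  simp [this]

theorem sum_levelWeight [Fintype ι] {c : ι → ℝ} {i : ι} (h0 : 0 ≤ c i) (h1 : c i ≤ 1) :
    ∑ s : Finset ι, (if i ∈ s then levelWeight c s else 0) = c i := by
  rw [← Finset.sum_filter]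
  unfold levelWeight
  rw [← measureReal_biUnion_finset]
  · have : (⋃ s ∈ Finset.univ.filter fun s : Finset ι => i ∈ s, levels c s) = Set.Iio (c i) := by
      ext t
      simp only [Finset.mem_filter, Finset.mem_univ, true_and, Set.mem_iUnion, exists_prop,
        Set.mem_Iio]
      constructor
      · rintro ⟨s, hs, ht⟩
        exact (ht i).1 hs
      · intro ht
        exact ⟨Finset.univ.filter fun j => t < c j, by simpa using ht, fun j => by simp⟩
    have hI : Set.Iio (c i) ∩ Set.Ico 0 1 = Set.Ico 0 (c i) := by
      ext t
      simp only [Set.mem_inter_iff, Set.mem_Iio, Set.mem_Ico]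
      exact ⟨fun h => ⟨h.2.1, h.1⟩, fun h => ⟨h.2, h.1, h.2.trans_le h1⟩⟩
    rw [this, measureReal_restrict_apply measurableSet_Iio, hI]
    simp [Measure.real, h0]
  · intro s _ s' _ hss'
    refine Set.disjoint_left.2 fun t ht ht' => hss' ?_
    ext j
    rw [ht j, ht' j]
  · exact fun s _ => measurableSet_levels c s

theorem sum_card_mul_levelWeight [Fintype ι] (x : K.Realization) :
    ∑ s : Finset ι, s.card * levelWeight x.coord s = 1 := by
  calc ∑ s : Finset ι, s.card * levelWeight x.coord s
      = ∑ s : Finset ι, ∑ i, (if i ∈ s then levelWeight x.coord s else 0) := by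
        refine Finset.sum_congr rfl fun s _ => ?_
        rw [Finset.sum_ite_mem, Finset.univ_inter, Finset.sum_const, nsmul_eq_mul]
    _ = ∑ i, x.coord i := by
        rw [Finset.sum_comm]
        exact Finset.sum_congr rfl fun i _ =>
          sum_levelWeight (x.coord_nonneg i) (x.coord_le_one i)
    _ = 1 := by simpa [finsum_eq_sum_of_fintype] using x.sum_coord

theorem surjective_subdivisionMap : Function.Surjective K.subdivisionMap := by
  have := Fintype.ofFinite ι
  intro x
  have hsum : ∑ᶠ s : Finset ι, s.card * levelWeight x.coord s = 1 := by
    rw [finsum_eq_sum_of_fintype]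
    exact sum_card_mul_levelWeight x
  have hface : ∃ c ∈ K.subdivision.faces, ∀ s : Finset ι,
      s.card * levelWeight x.coord s ≠ 0 → s ∈ c := by
    refine ⟨Finset.univ.filter fun s : Finset ι => s.card * levelWeight x.coord s ≠ 0,
      ⟨?_, ?_, ?_⟩, fun s hs => by simpa using hs⟩
    · by_contra h
      rw [Finset.not_nonempty_iff_eq_empty, Finset.filter_eq_empty_iff] at h
      rw [finsum_eq_sum_of_fintype, Finset.sum_eq_zero fun s hs => not_not.1 (h hs)] at hsum
      exact zero_ne_one hsum
    · intro s hs
      obtain ⟨h1, h2⟩ := mul_ne_zero_iff.1 (Finset.mem_filter.1 hs).2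
      obtain ⟨f, hf, hx⟩ := x.support_mem
      obtain ⟨t, ht0, ht⟩ := exists_mem_levels h2
      refine (K.isRelLowerSet_faces hf).2 (fun i hi => ?_) ?_
      · have : i ∈ Function.support x.coord := (ht0.trans_lt ((ht i).1 hi)).ne'
        rwa [hx] at this
      · exact Finset.card_ne_zero.1 (by exact_mod_cast h1)
    · intro s hs s' hs' _
      obtain ⟨t, -, ht⟩ := exists_mem_levels
        (mul_ne_zero_iff.1 (Finset.mem_filter.1 (Finset.mem_coe.1 hs)).2).2
      obtain ⟨t', -, ht'⟩ := exists_mem_levels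
        (mul_ne_zero_iff.1 (Finset.mem_filter.1 (Finset.mem_coe.1 hs')).2).2
      rcases le_total t t' with h | h
      · exact Or.inr fun i hi => (ht i).2 (h.trans_lt ((ht' i).1 hi))
      · exact Or.inl fun i hi => (ht' i).2 (h.trans_lt ((ht i).1 hi))
  obtain ⟨c, hc, hs⟩ := hface
  refine ⟨⟨fun s => s.card * levelWeight x.coord s,
    fun s => mul_nonneg (Nat.cast_nonneg _) (levelWeight_nonneg _ _), hsum,
    exists_support_eq hc hsum hs⟩, Realization.ext (funext fun i => ?_)⟩
  rw [subdivisionMap_coord, ← sum_levelWeight (x.coord_nonneg i) (x.coord_le_one i)]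
  refine Finset.sum_congr rfl fun s _ => ?_
  split_ifs with hi
  · have : (s.card : ℝ) ≠ 0 := by exact_mod_cast Finset.card_ne_zero.2 ⟨i, hi⟩
    field_simp
  · rfl

theorem coord_le_card_mul_levelWeight (y : K.subdivision.Realization) (s : Finset ι) :
    y.coord s ≤ s.card * levelWeight (K.subdivisionMap y).coord s := by
  have := Fintype.ofFinite ι
  by_cases hs : y.coord s = 0
  · rw [hs]
    exact mul_nonneg (Nat.cast_nonneg _) (levelWeight_nonneg _ _)
  obtain ⟨c, hc, hy⟩ := y.support_mem
  have hmem : ∀ t, y.coord t ≠ 0 → t ∈ c := fun t ht => by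
    simpa [hy] using (show t ∈ Function.support y.coord from ht)
  obtain ⟨i₀, hi₀⟩ := (K.isRelLowerSet_faces (hc.2.1 s (hmem s hs))).1
  have hcard : (0 : ℝ) < s.card := by exact_mod_cast Finset.card_pos.2 ⟨i₀, hi₀⟩
  have hnn : ∀ t : Finset ι, 0 ≤ y.coord t / t.card := fun t =>
    div_nonneg (y.coord_nonneg t) (Nat.cast_nonneg _)
  set x := K.subdivisionMap y with hx
  set φ := ∑ t : Finset ι, if s ⊂ t then y.coord t / t.card else 0 with hφ
  set δ := y.coord s / s.card with hδ
  have hφ0 : 0 ≤ φ := Finset.sum_nonneg fun t _ => by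
    split_ifs
    · exact hnn t
    · exact le_rfl
  have hin : ∀ i ∈ s, φ + δ ≤ x.coord i := by
    intro i hi
    have hδs : δ = ∑ t : Finset ι, if s = t then y.coord t / t.card else 0 := by simp [hδ]
    rw [hx, subdivisionMap_coord, hφ, hδs, ← Finset.sum_add_distrib]
    refine Finset.sum_le_sum fun t _ => ?_
    by_cases hst : s = t
    · subst hst
      simp [hi]
    · by_cases hst' : s ⊂ t
      · simp [hst', hst, hst'.1 hi]
      · simp only [hst, hst', if_false, add_zero]
        split_ifs
        · exact hnn t
        · exact le_rfl
  have hout : ∀ i, i ∉ s → x.coord i ≤ φ := by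
    intro i hi
    rw [hx, subdivisionMap_coord]
    refine Finset.sum_le_sum fun t _ => ?_
    by_cases hit : i ∈ t
    · by_cases ht : y.coord t = 0
      · simp [ht]
      · have hst : s ⊂ t := by
          have hne : s ≠ t := fun h => hi (h ▸ hit)
          rcases hc.2.2.total (hmem s hs) (hmem t ht) with h | h
          · exact Finset.ssubset_iff_subset_ne.2 ⟨h, hne⟩
          · exact absurd (h hit) hi
        simp [hit, hst]
    · simp only [hit, if_false]
      split_ifs
      · exact hnn t
      · exact le_rfl
  have hsub : Set.Ico φ (φ + δ) ⊆ levels x.coord s ∩ Set.Ico 0 1 := by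
    rintro t ⟨h1, h2⟩
    refine ⟨fun i => ⟨fun hi => h2.trans_le (hin i hi), fun hi => ?_⟩, hφ0.trans h1, ?_⟩
    · by_contra h
      exact absurd (h1.trans_lt hi) (not_lt.2 (hout i h))
    · exact h2.trans_le ((hin i₀ hi₀).trans (x.coord_le_one i₀))
  have hvol : δ ≤ levelWeight x.coord s := by
    rw [levelWeight, measureReal_restrict_apply (measurableSet_levels _ s)]
    calc δ = volume.real (Set.Ico φ (φ + δ)) := by simp [Measure.real, hnn s, hδ]
      _ ≤ _ := measureReal_mono hsub
        (measure_ne_top_of_subset Set.inter_subset_right (by simp))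
  calc y.coord s = s.card * δ := by rw [hδ]; field_simp
    _ ≤ _ := mul_le_mul_of_nonneg_left hvol hcard.le

theorem coord_eq_card_mul_levelWeight (y : K.subdivision.Realization) (s : Finset ι) :
    y.coord s = s.card * levelWeight (K.subdivisionMap y).coord s := by
  have := Fintype.ofFinite ι
  refine (Finset.sum_eq_sum_iff_of_le fun s _ => coord_le_card_mul_levelWeight y s).1 ?_ s
    (Finset.mem_univ s)
  rw [sum_card_mul_levelWeight, ← y.sum_coord, finsum_eq_sum_of_fintype]

theorem injective_subdivisionMap : Function.Injective K.subdivisionMap := fun y y' h =>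
  Realization.ext (funext fun s => by
    rw [coord_eq_card_mul_levelWeight y, coord_eq_card_mul_levelWeight y', h])

variable (K) in
/-- The realization of the barycentric subdivision of `K` is homeomorphic to that of `K`. -/
noncomputable def subdivisionHomeo : K.subdivision.Realization ≃ₜ K.Realization :=
  Continuous.homeoOfEquivCompactToT2
    (f := Equiv.ofBijective K.subdivisionMap ⟨injective_subdivisionMap, surjective_subdivisionMap⟩)
    continuous_subdivisionMap

variable (K) in
/-- The homeomorphism from the realization of the barycentric subdivision, as a map. -/
noncomputable def sdMap : C(K.subdivision.Realization, K.Realization) := subdivisionHomeo K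

variable (K) in
/-- The inverse of the homeomorphism from the realization of the barycentric subdivision. -/
noncomputable def sdInv : C(K.Realization, K.subdivision.Realization) := (subdivisionHomeo K).symm

theorem sdMap_apply (y : K.subdivision.Realization) : sdMap K y = K.subdivisionMap y := rfl

theorem sdMap_comp_sdInv : (sdMap K).comp (sdInv K) = ContinuousMap.id _ := by
  ext x : 1
  exact (subdivisionHomeo K).apply_symm_apply x

theorem sdInv_comp_sdMap : (sdInv K).comp (sdMap K) = ContinuousMap.id _ := by
  ext x : 1
  exact (subdivisionHomeo K).symm_apply_apply x

theorem exists_of_sdMap_coord_ne_zero {y : K.subdivision.Realization} {i : ι}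
    (h : (sdMap K y).coord i ≠ 0) : ∃ s, y.coord s ≠ 0 ∧ i ∈ s := by
  have := Fintype.ofFinite ι
  rw [sdMap_apply, subdivisionMap_coord] at h
  obtain ⟨s, -, hs⟩ := Finset.exists_ne_zero_of_sum_ne_zero h
  by_cases his : i ∈ s
  · refine ⟨s, fun h0 => hs ?_, his⟩
    simp [h0]
  · simp [his] at hs

/-- A chain of faces, supporting a point of the subdivision, has a largest element. -/
theorem exists_face_of_subdivision (y : K.subdivision.Realization) :
    ∃ m ∈ K.faces, ∀ s, y.coord s ≠ 0 → s ∈ K.faces ∧ s ⊆ m := by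
  obtain ⟨c, hc, hy⟩ := y.support_mem
  have hmem : ∀ t, y.coord t ≠ 0 → t ∈ c := fun t ht => by
    simpa [hy] using (show t ∈ Function.support y.coord from ht)
  obtain ⟨m, hm, hmax⟩ := c.exists_max_image Finset.card hc.1
  refine ⟨m, hc.2.1 m hm, fun s hs => ⟨hc.2.1 s (hmem s hs), ?_⟩⟩
  rcases hc.2.2.total (hmem s hs) hm with h | h
  · exact h
  · exact (Finset.eq_of_subset_of_card_le h (hmax s (hmem s hs))).symm.subset

variable {Γ : Type*} [Group Γ] [MulAction Γ ι] [IsGInvariant Γ K]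

instance : IsGInvariant Γ K.subdivision where
  map_mem γ c hc := by
    refine ⟨hc.1.map, ?_, ?_⟩
    · intro s hs
      obtain ⟨t, ht, rfl⟩ := Finset.mem_map.1 hs
      exact smul_mem_faces γ (hc.2.1 t ht)
    · rw [Finset.coe_map]
      refine hc.2.2.image_of_map_rel (· ≤ ·) (· ≤ ·) _ ?_
      intro s t hst
      exact Finset.smul_finset_subset_smul_finset hst

instance : IsGInvariant Γ (orderComplex K.faces) :=
  inferInstanceAs (IsGInvariant Γ K.subdivision)

theorem isGMap_sdMap : IsGMap Γ (sdMap K) := by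
  have := Fintype.ofFinite ι
  intro γ y
  refine Realization.ext (funext fun i => ?_)
  change (K.subdivisionMap (γ • y)).coord i = (K.subdivisionMap y).coord (γ⁻¹ • i)
  rw [subdivisionMap_coord, subdivisionMap_coord, ← Equiv.sum_comp (MulAction.toPerm γ)]
  refine Finset.sum_congr rfl fun s _ => ?_
  change (if i ∈ γ • s then y.coord (γ⁻¹ • γ • s) / (γ • s).card else 0) = _
  simp only [inv_smul_smul, Finset.card_smul_finset, Finset.inv_smul_mem_iff]

theorem isGMap_sdInv : IsGMap Γ (sdInv K) := by
  intro γ x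
  apply (subdivisionHomeo K).injective
  have h := isGMap_sdMap γ (sdInv K x)
  have h' : ∀ x, sdMap K (sdInv K x) = x := (subdivisionHomeo K).apply_symm_apply
  rw [h'] at h
  exact (h' _).trans h.symm

end Subdivision

/-! ### Maps defined on the subdivision -/

section OrderComplex

open scoped Classical

variable {α β : Type*} [PartialOrder α] [PartialOrder β] {P : Set α} {Q : Set β}

theorem exists_isGreatest {c : Finset α} (hc : c ∈ (orderComplex P).faces) :
    ∃ m, IsGreatest (c : Set α) m := by
  obtain ⟨m, hm⟩ := c.exists_maximal hc.1
  refine ⟨m, hm.prop, fun a ha => ?_⟩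
  rcases hc.2.2.total ha hm.prop with h | h
  · exact h
  · exact hm.le_of_ge ha h

theorem exists_isLeast {c : Finset α} (hc : c ∈ (orderComplex P).faces) :
    ∃ m, IsLeast (c : Set α) m := by
  obtain ⟨m, hm⟩ := c.exists_minimal hc.1
  refine ⟨m, hm.prop, fun a ha => ?_⟩
  rcases hc.2.2.total ha hm.prop with h | h
  · exact hm.le_of_le ha h
  · exact h

theorem isSimplicial_of_monotoneOn {f : α → β} (hf : Set.MapsTo f P Q) (hm : MonotoneOn f P) :
    IsSimplicial (orderComplex P) (orderComplex Q) f := by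
  intro c hc
  refine ⟨hc.1.image _, fun b hb => ?_, ?_⟩
  · obtain ⟨a, ha, rfl⟩ := Finset.mem_image.1 hb
    exact hf (hc.2.1 a ha)
  · rw [Finset.coe_image]
    rintro _ ⟨a, ha, rfl⟩ _ ⟨b, hb, rfl⟩ -
    rcases hc.2.2.total ha hb with h | h
    · exact Or.inl (hm (hc.2.1 a ha) (hc.2.1 b hb) h)
    · exact Or.inr (hm (hc.2.1 b hb) (hc.2.1 a ha) h)

theorem isSimplicial_of_antitoneOn {f : α → β} (hf : Set.MapsTo f P Q) (hm : AntitoneOn f P) :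
    IsSimplicial (orderComplex P) (orderComplex Q) f := by
  intro c hc
  refine ⟨hc.1.image _, fun b hb => ?_, ?_⟩
  · obtain ⟨a, ha, rfl⟩ := Finset.mem_image.1 hb
    exact hf (hc.2.1 a ha)
  · rw [Finset.coe_image]
    rintro _ ⟨a, ha, rfl⟩ _ ⟨b, hb, rfl⟩ -
    rcases hc.2.2.total ha hb with h | h
    · exact Or.inr (hm (hc.2.1 a ha) (hc.2.1 b hb) h)
    · exact Or.inl (hm (hc.2.1 b hb) (hc.2.1 a ha) h)

theorem isSimplicial_of_mem {ι : Type*} {K : PreAbstractSimplicialComplex ι} {φ : Finset ι → ι}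
    (hφ : ∀ s ∈ K.faces, φ s ∈ s) : IsSimplicial K.subdivision K φ := by
  intro c hc
  obtain ⟨m, hm, hmax⟩ := exists_isGreatest hc
  refine (K.isRelLowerSet_faces (hc.2.1 m hm)).2 (fun i hi => ?_) (hc.1.image _)
  obtain ⟨s, hs, rfl⟩ := Finset.mem_image.1 hi
  exact hmax hs (hφ s (hc.2.1 s hs))

theorem IsSimplicial.image {ι κ : Type*} {K : PreAbstractSimplicialComplex ι}
    {L : PreAbstractSimplicialComplex κ} {f : ι → κ} (hf : IsSimplicial K L f) :
    IsSimplicial K.subdivision L.subdivision (Finset.image f) :=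
  isSimplicial_of_monotoneOn hf fun _ _ _ _ h => Finset.image_subset_image h

theorem exists_isLeast_choice [Nonempty α] (P : Set α) : ∃ φ : Finset α → α,
    ∀ c ∈ (orderComplex P).faces, IsLeast (c : Set α) (φ c) := by
  have h : ∀ c : Finset α, ∃ m, c ∈ (orderComplex P).faces → IsLeast (c : Set α) m := fun c => by
    by_cases hc : c ∈ (orderComplex P).faces
    · exact (exists_isLeast hc).imp fun _ h _ => h
    · exact ⟨Classical.arbitrary α, fun h => absurd h hc⟩
  choose φ hφ using h
  exact ⟨φ, hφ⟩

theorem exists_isGreatest_choice [Nonempty α] (P : Set α) : ∃ φ : Finset α → α,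
    ∀ c ∈ (orderComplex P).faces, IsGreatest (c : Set α) (φ c) := by
  have h : ∀ c : Finset α, ∃ m, c ∈ (orderComplex P).faces → IsGreatest (c : Set α) m := fun c => by
    by_cases hc : c ∈ (orderComplex P).faces
    · exact (exists_isGreatest hc).imp fun _ h _ => h
    · exact ⟨Classical.arbitrary α, fun h => absurd h hc⟩
  choose φ hφ using h
  exact ⟨φ, hφ⟩

end OrderComplex

open scoped Classical in
theorem image_smul_finset {Γ ι κ : Type*} [Group Γ] [MulAction Γ ι] [MulAction Γ κ]
    {f : ι → κ} {s : Finset ι} {γ : Γ} (h : ∀ i ∈ s, f (γ • i) = γ • f i) :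
    (γ • s).image f = γ • s.image f := by
  ext j
  simp only [Finset.mem_image, Finset.mem_smul_finset]
  constructor
  · rintro ⟨_, ⟨i, hi, rfl⟩, rfl⟩
    exact ⟨f i, ⟨i, hi, rfl⟩, (h i hi).symm⟩
  · rintro ⟨_, ⟨i, hi, rfl⟩, rfl⟩
    exact ⟨γ • i, ⟨i, hi, rfl⟩, h i hi⟩

section Equivariant

open scoped Classical

variable {Γ ι κ μ : Type*} [Group Γ] [Finite ι] [Finite κ] [Finite μ]
  [MulAction Γ ι] [MulAction Γ κ] [MulAction Γ μ]
  {K : PreAbstractSimplicialComplex ι} {L : PreAbstractSimplicialComplex κ}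
  {N : PreAbstractSimplicialComplex μ}
  [IsGInvariant Γ K] [IsGInvariant Γ L] [IsGInvariant Γ N]

/-- The map of realizations induced by a simplicial map defined on the barycentric subdivision. -/
noncomputable def sdRealizationMap (E : Finset ι → κ) (hE : IsSimplicial K.subdivision L E) :
    C(K.Realization, L.Realization) :=
  (realizationMap E hE).comp (sdInv K)

theorem isGMap_realizationMap_subdivision {E : Finset ι → κ} (hE : IsSimplicial K.subdivision L E)
    (h : ∀ s ∈ K.faces, ∀ γ : Γ, E (γ • s) = γ • E s) : IsGMap Γ (realizationMap E hE) :=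
  isGMap_realizationMap hE fun _ hc s hs => h s (hc.2.1 s hs)

theorem isGMap_sdRealizationMap {E : Finset ι → κ} (hE : IsSimplicial K.subdivision L E)
    (h : ∀ s ∈ K.faces, ∀ γ : Γ, E (γ • s) = γ • E s) : IsGMap Γ (sdRealizationMap E hE) :=
  (isGMap_realizationMap_subdivision hE h).comp isGMap_sdInv

theorem sdRealizationMap_subdivisionMap (E : Finset ι → κ) (hE : IsSimplicial K.subdivision L E)
    (y : K.subdivision.Realization) :
    sdRealizationMap E hE (K.subdivisionMap y) = Realization.map E hE y :=
  congrArg (realizationMap E hE) ((subdivisionHomeo K).symm_apply_apply y)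

theorem GHomotopic.sdRealizationMap {E E' : Finset ι → κ} {hE : IsSimplicial K.subdivision L E}
    {hE' : IsSimplicial K.subdivision L E'}
    (h : GHomotopic Γ (realizationMap E hE) (realizationMap E' hE')) :
    GHomotopic Γ (sdRealizationMap E hE) (sdRealizationMap E' hE') :=
  h.precomp isGMap_sdInv

theorem realizationMap_comp_sdRealizationMap {E : Finset ι → κ} {f : κ → μ}
    (hf : IsSimplicial L N f) (hE : IsSimplicial K.subdivision L E) :
    (realizationMap f hf).comp (sdRealizationMap E hE) =
      sdRealizationMap (f ∘ E) (hf.comp hE) := by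
  rw [sdRealizationMap, ← ContinuousMap.comp_assoc, realizationMap_comp]
  rfl

/-- A vertex map selecting a vertex of each face approximates the identity. -/
theorem gHomotopic_sdRealizationMap_id {φ : Finset ι → ι} (hφ : ∀ s ∈ K.faces, φ s ∈ s)
    (h : ∀ s ∈ K.faces, ∀ γ : Γ, φ (γ • s) = γ • φ s) :
    GHomotopic Γ (sdRealizationMap φ (isSimplicial_of_mem hφ)) (ContinuousMap.id K.Realization) := by
  rw [← sdMap_comp_sdInv]
  refine GHomotopic.precomp (Contiguous.gHomotopic (fun y => ?_)
    (isGMap_realizationMap_subdivision _ h) isGMap_sdMap) isGMap_sdInv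
  obtain ⟨m, hm, hs⟩ := exists_face_of_subdivision y
  refine ⟨m, hm, fun i hi => ?_⟩
  rcases hi with hi | hi
  · obtain ⟨s, hys, rfl⟩ := exists_of_realizationMap_coord_ne_zero hi
    exact (hs s hys).2 (hφ s (hs s hys).1)
  · obtain ⟨s, hys, his⟩ := exists_of_sdMap_coord_ne_zero hi
    exact (hs s hys).2 his

/-- Barycentric subdivision is natural up to homotopy. -/
theorem gHomotopic_sdRealizationMap_comp {f : ι → κ} (hf : IsSimplicial K L f)
    (hfΓ : ∀ s ∈ K.faces, ∀ i ∈ s, ∀ γ : Γ, f (γ • i) = γ • f i)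
    {E : Finset κ → μ} (hE : IsSimplicial L.subdivision N E)
    (hEΓ : ∀ s ∈ L.faces, ∀ γ : Γ, E (γ • s) = γ • E s) :
    GHomotopic Γ ((sdRealizationMap E hE).comp (realizationMap f hf))
      (sdRealizationMap (E ∘ Finset.image f) (hE.comp hf.image)) := by
  have hfG : IsGMap Γ (realizationMap f hf) := isGMap_realizationMap hf hfΓ
  have hiG : IsGMap Γ (realizationMap _ hf.image) :=
    isGMap_realizationMap_subdivision hf.image fun s hs γ =>
      image_smul_finset fun i hi => hfΓ s hs i hi γ
  have hnat : GHomotopic Γ ((realizationMap f hf).comp (sdMap K))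
      ((sdMap L).comp (realizationMap _ hf.image)) := by
    refine Contiguous.gHomotopic (fun y => ?_) (hfG.comp isGMap_sdMap) (isGMap_sdMap.comp hiG)
    obtain ⟨m, hm, hs⟩ := exists_face_of_subdivision y
    refine ⟨m.image f, hf m hm, fun j hj => ?_⟩
    rcases hj with hj | hj
    · obtain ⟨i, hi, rfl⟩ := exists_of_realizationMap_coord_ne_zero (hf := hf) hj
      obtain ⟨s, hys, his⟩ := exists_of_sdMap_coord_ne_zero hi
      exact Finset.mem_image_of_mem f ((hs s hys).2 his)
    · obtain ⟨_, ht, hjt⟩ := exists_of_sdMap_coord_ne_zero hj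
      obtain ⟨s, hys, rfl⟩ := exists_of_realizationMap_coord_ne_zero (hf := hf.image) ht
      exact Finset.image_subset_image (hs s hys).2 hjt
  have h := (hnat.postcomp (isGMap_sdRealizationMap hE hEΓ)).precomp (isGMap_sdInv (K := K))
  have h₁ : ((sdRealizationMap E hE).comp ((realizationMap f hf).comp (sdMap K))).comp (sdInv K) =
      (sdRealizationMap E hE).comp (realizationMap f hf) := by
    rw [ContinuousMap.comp_assoc, ContinuousMap.comp_assoc, sdMap_comp_sdInv]
    rfl
  have h₂ : ((sdRealizationMap E hE).comp ((sdMap L).comp (realizationMap _ hf.image))).comp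
      (sdInv K) = sdRealizationMap (E ∘ Finset.image f) (hE.comp hf.image) := by
    rw [← ContinuousMap.comp_assoc, sdRealizationMap, ContinuousMap.comp_assoc _ (sdInv L),
      sdInv_comp_sdMap, ContinuousMap.comp_id, realizationMap_comp]
    rfl
  rwa [h₁, h₂] at h

end Equivariant

/-! ### Homotopies between poset maps -/

section PosetMaps

open scoped Classical

variable {Γ α β : Type*} [Group Γ] [MulAction Γ α] [MulAction Γ β] [PartialOrder α]
  [PartialOrder β] {P : Set α} {Q : Set β}

theorem isLeast_smul_finset (hα : ∀ γ : Γ, Monotone (γ • · : α → α)) {c : Finset α} {m : α}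
    (h : IsLeast (c : Set α) m) (γ : Γ) : IsLeast ((γ • c : Finset α) : Set α) (γ • m) := by
  refine ⟨Finset.smul_mem_smul_finset h.1, ?_⟩
  intro a ha
  obtain ⟨b, hb, rfl⟩ := Finset.mem_smul_finset.1 (Finset.mem_coe.1 ha)
  exact hα γ (h.2 hb)

theorem isGreatest_smul_finset (hα : ∀ γ : Γ, Monotone (γ • · : α → α)) {c : Finset α} {m : α}
    (h : IsGreatest (c : Set α) m) (γ : Γ) : IsGreatest ((γ • c : Finset α) : Set α) (γ • m) := by
  refine ⟨Finset.smul_mem_smul_finset h.1, ?_⟩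
  intro a ha
  obtain ⟨b, hb, rfl⟩ := Finset.mem_smul_finset.1 (Finset.mem_coe.1 ha)
  exact hα γ (h.2 hb)

variable [IsGInvariant Γ (orderComplex P)] [IsGInvariant Γ (orderComplex Q)]

theorem isLeast_choice_smul (hα : ∀ γ : Γ, Monotone (γ • · : α → α)) {φ : Finset α → α}
    (hφ : ∀ c ∈ (orderComplex P).faces, IsLeast (c : Set α) (φ c)) :
    ∀ c ∈ (orderComplex P).faces, ∀ γ : Γ, φ (γ • c) = γ • φ c := fun c hc γ =>
  (hφ _ (smul_mem_faces γ hc)).unique (isLeast_smul_finset hα (hφ c hc) γ)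

theorem isGreatest_choice_smul (hα : ∀ γ : Γ, Monotone (γ • · : α → α)) {φ : Finset α → α}
    (hφ : ∀ c ∈ (orderComplex P).faces, IsGreatest (c : Set α) (φ c)) :
    ∀ c ∈ (orderComplex P).faces, ∀ γ : Γ, φ (γ • c) = γ • φ c := fun c hc γ =>
  (hφ _ (smul_mem_faces γ hc)).unique (isGreatest_smul_finset hα (hφ c hc) γ)

variable [Finite α] [Finite β]

theorem isGMap_realizationMap_orderComplex {f : α → β}
    (hf : IsSimplicial (orderComplex P) (orderComplex Q) f)
    (h : ∀ a ∈ P, ∀ γ : Γ, f (γ • a) = γ • f a) : IsGMap Γ (realizationMap f hf) :=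
  isGMap_realizationMap hf fun _ hs i hi => h i (hs.2.1 i hi)

variable [Nonempty α]

/-- Comparable equivariant poset maps are equivariantly homotopic. -/
theorem gHomotopic_of_le (hα : ∀ γ : Γ, Monotone (γ • · : α → α)) {f g : α → β}
    (hf : Set.MapsTo f P Q) (hg : Set.MapsTo g P Q) (hfm : MonotoneOn f P) (hgm : MonotoneOn g P)
    (hfΓ : ∀ a ∈ P, ∀ γ : Γ, f (γ • a) = γ • f a) (hgΓ : ∀ a ∈ P, ∀ γ : Γ, g (γ • a) = γ • g a)
    (hle : ∀ a ∈ P, f a ≤ g a) :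
    GHomotopic Γ (realizationMap f (isSimplicial_of_monotoneOn hf hfm))
      (realizationMap g (isSimplicial_of_monotoneOn hg hgm)) := by
  obtain ⟨mn, hmn⟩ := exists_isLeast_choice P
  obtain ⟨mx, hmx⟩ := exists_isGreatest_choice P
  have hfs := isSimplicial_of_monotoneOn hf hfm
  have hgs := isSimplicial_of_monotoneOn hg hgm
  have hns := isSimplicial_of_mem fun c hc => (hmn c hc).1
  have hxs := isSimplicial_of_mem fun c hc => (hmx c hc).1
  have hnΓ := isLeast_choice_smul hα hmn
  have hxΓ := isGreatest_choice_smul hα hmx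
  have hnP : ∀ c ∈ (orderComplex P).faces, mn c ∈ P := fun c hc => hc.2.1 _ (hmn c hc).1
  have hxP : ∀ c ∈ (orderComplex P).faces, mx c ∈ P := fun c hc => hc.2.1 _ (hmx c hc).1
  have h₁ := (gHomotopic_sdRealizationMap_id (fun c hc => (hmn c hc).1) hnΓ).postcomp
    (isGMap_realizationMap_orderComplex hfs hfΓ)
  have h₂ := (gHomotopic_sdRealizationMap_id (fun c hc => (hmx c hc).1) hxΓ).postcomp
    (isGMap_realizationMap_orderComplex hgs hgΓ)
  rw [realizationMap_comp_sdRealizationMap, ContinuousMap.comp_id] at h₁ h₂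
  refine h₁.symm.trans (GHomotopic.trans (GHomotopic.sdRealizationMap ?_) h₂)
  refine Contiguous.gHomotopic (fun y => ?_)
    (isGMap_realizationMap_subdivision _ fun c hc γ => ?_)
    (isGMap_realizationMap_subdivision _ fun c hc γ => ?_)
  · obtain ⟨C, hC, hy⟩ := y.support_mem
    have hmem : ∀ c, y.coord c ≠ 0 → c ∈ C := fun c hc => by
      simpa [hy] using (show c ∈ Function.support y.coord from hc)
    have hcross : ∀ c ∈ C, ∀ d ∈ C, f (mn c) ≤ g (mx d) := by
      intro c hc d hd
      have hcf := hC.2.1 c hc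
      have hdf := hC.2.1 d hd
      have hle' : mn c ≤ mx d := by
        rcases hC.2.2.total hc hd with h | h
        · exact (hmx d hdf).2 (h (hmn c hcf).1)
        · exact (hmn c hcf).2 (h (hmx d hdf).1)
      exact (hle _ (hnP c hcf)).trans (hgm (hnP c hcf) (hxP d hdf) hle')
    refine ⟨C.image (f ∘ mn) ∪ C.image (g ∘ mx), ⟨?_, ?_, ?_⟩, ?_⟩
    · exact (hC.1.image _).mono Finset.subset_union_left
    · intro b hb
      rcases Finset.mem_union.1 hb with hb | hb
      · exact ((hfs.comp hns) C hC).2.1 b hb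
      · exact ((hgs.comp hxs) C hC).2.1 b hb
    · intro b hb d hd hbd
      rw [Finset.mem_coe, Finset.mem_union] at hb hd
      rcases hb with hb | hb <;> rcases hd with hd | hd
      · exact ((hfs.comp hns) C hC).2.2 hb hd hbd
      · obtain ⟨c, hc, rfl⟩ := Finset.mem_image.1 hb
        obtain ⟨e, he, rfl⟩ := Finset.mem_image.1 hd
        exact Or.inl (hcross c hc e he)
      · obtain ⟨c, hc, rfl⟩ := Finset.mem_image.1 hb
        obtain ⟨e, he, rfl⟩ := Finset.mem_image.1 hd
        exact Or.inr (hcross e he c hc)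
      · exact ((hgs.comp hxs) C hC).2.2 hb hd hbd
    · intro i hi
      rcases hi with hi | hi
      · obtain ⟨c, hc, rfl⟩ := exists_of_realizationMap_coord_ne_zero hi
        exact Finset.mem_union_left _ (Finset.mem_image_of_mem _ (hmem c hc))
      · obtain ⟨c, hc, rfl⟩ := exists_of_realizationMap_coord_ne_zero hi
        exact Finset.mem_union_right _ (Finset.mem_image_of_mem _ (hmem c hc))
  · rw [Function.comp_apply, hnΓ c hc, hfΓ _ (hnP c hc), Function.comp_apply]
  · rw [Function.comp_apply, hxΓ c hc, hgΓ _ (hxP c hc), Function.comp_apply]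

end PosetMaps

/-! ### Criteria for equivariant homotopy equivalence -/

open scoped Classical in
theorem monotone_smul_finset {Γ ι : Type*} [Group Γ] [MulAction Γ ι] (γ : Γ) :
    Monotone (γ • · : Finset ι → Finset ι) :=
  fun _ _ h => Finset.smul_finset_subset_smul_finset h

section Criteria

open scoped Classical

variable {Γ α β : Type*} [Group Γ] [MulAction Γ α] [MulAction Γ β] [PartialOrder α]
  [PartialOrder β] [Finite α] [Finite β]

/-- A poset map from the face poset of a complex with a section that is an upper adjoint is an
equivariant homotopy equivalence. -/
theorem isGHomotopyEquiv_sdRealizationMap {ι : Type*} [Finite ι] [MulAction Γ ι]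
    {K : PreAbstractSimplicialComplex ι} [IsGInvariant Γ K] {Q : Set β}
    [IsGInvariant Γ (orderComplex Q)] {F : Finset ι → β} (hF : Set.MapsTo F K.faces Q)
    (hFm : MonotoneOn F K.faces) (hFΓ : ∀ s ∈ K.faces, ∀ γ : Γ, F (γ • s) = γ • F s)
    {k : β → Finset ι} (hk : Set.MapsTo k Q K.faces) (hkm : MonotoneOn k Q)
    (hkΓ : ∀ b ∈ Q, ∀ γ : Γ, k (γ • b) = γ • k b) (hFk : ∀ b ∈ Q, F (k b) = b)
    (hkF : ∀ s ∈ K.faces, s ≤ k (F s)) :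
    IsGHomotopyEquiv Γ (sdRealizationMap (K := K) F
      (isSimplicial_of_monotoneOn hF hFm : IsSimplicial K.subdivision (orderComplex Q) F)) := by
  have hFs : IsSimplicial K.subdivision (orderComplex Q) F := isSimplicial_of_monotoneOn hF hFm
  have hks : IsSimplicial (orderComplex Q) K.subdivision k := isSimplicial_of_monotoneOn hk hkm
  have hkG : IsGMap Γ (realizationMap k hks) := isGMap_realizationMap hks
    fun _ hs i hi => hkΓ i (hs.2.1 i hi)
  refine ⟨isGMap_sdRealizationMap _ hFΓ, (sdMap K).comp (realizationMap k hks),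
    isGMap_sdMap.comp hkG, ?_, ?_⟩
  · have h : GHomotopic Γ (realizationMap id isSimplicial_id) (realizationMap (k ∘ F)
        (hks.comp hFs)) :=
      gHomotopic_of_le (P := K.faces) (Q := K.faces) monotone_smul_finset (fun _ h => h)
        (fun s hs => hk (hF hs)) (fun _ _ _ _ h => h)
        (fun s hs t ht h => hkm (hF hs) (hF ht) (hFm hs ht h)) (fun _ _ _ => rfl)
        (fun s hs γ => (congrArg k (hFΓ s hs γ)).trans (hkΓ _ (hF hs) γ))
        hkF
    have h' := (h.symm.postcomp isGMap_sdMap).precomp (isGMap_sdInv (Γ := Γ) (K := K))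
    rw [realizationMap_id, ContinuousMap.comp_id, sdMap_comp_sdInv, ← realizationMap_comp hks hFs]
      at h'
    exact h'
  · have h : (sdRealizationMap (K := K) F hFs).comp ((sdMap K).comp (realizationMap k hks)) =
        ContinuousMap.id _ := by
      rw [← ContinuousMap.comp_assoc, sdRealizationMap, ContinuousMap.comp_assoc _ (sdInv K),
        sdInv_comp_sdMap, ContinuousMap.comp_id, realizationMap_comp, ← realizationMap_id]
      exact realizationMap_congr _ _ fun s hs b hb => hFk b (hs.2.1 b hb)
    rw [h]
    exact GHomotopic.refl fun _ _ => rfl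

variable [Nonempty α]

/-- The inclusion `P ⊆ Q` is an equivariant homotopy equivalence as soon as there is a poset map
from the chains of `Q` to `P` lying below the maximum, and equal to it on the chains of `P`. -/
theorem gHomotopyEquivalent_of_le_max (hα : ∀ γ : Γ, Monotone (γ • · : α → α)) {P Q : Set α}
    [IsGInvariant Γ (orderComplex P)] [IsGInvariant Γ (orderComplex Q)] (hPQ : P ⊆ Q)
    {E : Finset α → α} (hE : Set.MapsTo E (orderComplex Q).faces P)
    (hEm : MonotoneOn E (orderComplex Q).faces)
    (hEΓ : ∀ c ∈ (orderComplex Q).faces, ∀ γ : Γ, E (γ • c) = γ • E c)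
    (hEQ : ∀ c ∈ (orderComplex Q).faces, ∀ m, IsGreatest (c : Set α) m → E c ≤ m)
    (hEP : ∀ c ∈ (orderComplex P).faces, ∀ m, IsGreatest (c : Set α) m → E c = m) :
    GHomotopyEquivalent Γ (orderComplex P).Realization (orderComplex Q).Realization := by
  have hi : IsSimplicial (orderComplex P) (orderComplex Q) id :=
    isSimplicial_of_monotoneOn hPQ fun _ _ _ _ h => h
  have hEs : IsSimplicial (orderComplex Q).subdivision (orderComplex P) E :=
    isSimplicial_of_monotoneOn hE hEm
  have hiG : IsGMap Γ (realizationMap id hi) :=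
    isGMap_realizationMap_orderComplex hi fun _ _ _ => rfl
  refine ⟨realizationMap id hi, hiG, sdRealizationMap E hEs, isGMap_sdRealizationMap hEs hEΓ,
    ?_, ?_⟩
  · refine (gHomotopic_sdRealizationMap_comp hi (fun _ _ _ _ _ => rfl) hEs hEΓ).trans ?_
    obtain ⟨mx, hmx⟩ := exists_isGreatest_choice P
    refine GHomotopic.trans (GHomotopic.sdRealizationMap ?_) (gHomotopic_sdRealizationMap_id
      (fun c hc => (hmx c hc).1) (isGreatest_choice_smul hα hmx))
    rw [realizationMap_congr (hEs.comp hi.image) (isSimplicial_of_mem fun c hc => (hmx c hc).1)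
      fun C hC c hc => ?_]
    · exact GHomotopic.refl (isGMap_realizationMap_subdivision _ (isGreatest_choice_smul hα hmx))
    · rw [Function.comp_apply, Finset.image_id]
      exact hEP c (hC.2.1 c hc) _ (hmx c (hC.2.1 c hc))
  · rw [realizationMap_comp_sdRealizationMap]
    obtain ⟨mx, hmx⟩ := exists_isGreatest_choice Q
    refine GHomotopic.trans (GHomotopic.sdRealizationMap ?_) (gHomotopic_sdRealizationMap_id
      (fun c hc => (hmx c hc).1) (isGreatest_choice_smul hα hmx))
    exact gHomotopic_of_le (P := (orderComplex Q).faces) (Q := Q) monotone_smul_finset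
      (fun c hc => hPQ (hE hc)) (fun c hc => hc.2.1 _ (hmx c hc).1) hEm
      (fun c hc d hd h => (hmx d hd).2 (h (hmx c hc).1)) hEΓ (isGreatest_choice_smul hα hmx)
      (fun c hc => hEQ c hc _ (hmx c hc))

variable [Nonempty β]

/-- The inclusion `Y ⊆ X` is an equivariant homotopy equivalence as soon as it has a homotopy
inverse that factors, after subdivisions, through an auxiliary poset `W`. -/
theorem gHomotopyEquivalent_of_factorization (hα : ∀ γ : Γ, Monotone (γ • · : α → α))
    (hβ : ∀ γ : Γ, Monotone (γ • · : β → β)) {X Y : Set α} {W : Set β}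
    [IsGInvariant Γ (orderComplex X)] [IsGInvariant Γ (orderComplex Y)]
    [IsGInvariant Γ (orderComplex W)] (hYX : Y ⊆ X)
    {A : Finset α → β} (hA : Set.MapsTo A (orderComplex X).faces W)
    (hAm : AntitoneOn A (orderComplex X).faces)
    (hAΓ : ∀ c ∈ (orderComplex X).faces, ∀ γ : Γ, A (γ • c) = γ • A c)
    {B : Finset β → α} (hB : Set.MapsTo B (orderComplex W).faces Y)
    (hBm : MonotoneOn B (orderComplex W).faces)
    (hBΓ : ∀ c ∈ (orderComplex W).faces, ∀ γ : Γ, B (γ • c) = γ • B c)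
    {π : β → α} (hπ : Set.MapsTo π W X) (hπm : MonotoneOn π W)
    (hπΓ : ∀ w ∈ W, ∀ γ : Γ, π (γ • w) = γ • π w)
    {j : α → β} (hj : Set.MapsTo j Y W) (hjm : MonotoneOn j Y)
    (hjΓ : ∀ a ∈ Y, ∀ γ : Γ, j (γ • a) = γ • j a)
    (hπA : ∀ c ∈ (orderComplex X).faces, ∀ m, IsLeast (c : Set α) m → π (A c) = m)
    (hAY : ∀ c ∈ (orderComplex Y).faces, ∀ m, IsLeast (c : Set α) m → A c = j m)
    (hπB : ∀ c ∈ (orderComplex W).faces, ∀ m, IsGreatest (c : Set β) m → π m ≤ B c)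
    (hBj : ∀ c ∈ (orderComplex Y).faces, ∀ m, IsGreatest (c : Set α) m → B (c.image j) = m) :
    GHomotopyEquivalent Γ (orderComplex Y).Realization (orderComplex X).Realization := by
  have hi : IsSimplicial (orderComplex Y) (orderComplex X) id :=
    isSimplicial_of_monotoneOn hYX fun _ _ _ _ h => h
  have hAs : IsSimplicial (orderComplex X).subdivision (orderComplex W) A :=
    isSimplicial_of_antitoneOn hA hAm
  have hBs : IsSimplicial (orderComplex W).subdivision (orderComplex Y) B :=
    isSimplicial_of_monotoneOn hB hBm
  have hπs := isSimplicial_of_monotoneOn hπ hπm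
  have hjs := isSimplicial_of_monotoneOn hj hjm
  have hiG : IsGMap Γ (realizationMap id hi) :=
    isGMap_realizationMap_orderComplex hi fun _ _ _ => rfl
  have hπG : IsGMap Γ (realizationMap π hπs) := isGMap_realizationMap_orderComplex hπs hπΓ
  have hjG : IsGMap Γ (realizationMap j hjs) := isGMap_realizationMap_orderComplex hjs hjΓ
  have hAG : IsGMap Γ (sdRealizationMap A hAs) := isGMap_sdRealizationMap hAs hAΓ
  have hBG : IsGMap Γ (sdRealizationMap B hBs) := isGMap_sdRealizationMap hBs hBΓ
  refine ⟨realizationMap id hi, hiG, (sdRealizationMap B hBs).comp (sdRealizationMap A hAs),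
    hBG.comp hAG, ?_, ?_⟩
  · obtain ⟨mn, hmn⟩ := exists_isLeast_choice Y
    obtain ⟨mx, hmx⟩ := exists_isGreatest_choice Y
    have h₁ : GHomotopic Γ ((sdRealizationMap A hAs).comp (realizationMap id hi))
        (realizationMap j hjs) := by
      refine (gHomotopic_sdRealizationMap_comp hi (fun _ _ _ _ _ => rfl) hAs hAΓ).trans ?_
      have h := (gHomotopic_sdRealizationMap_id (fun c hc => (hmn c hc).1)
        (isLeast_choice_smul hα hmn)).postcomp hjG
      rw [realizationMap_comp_sdRealizationMap, ContinuousMap.comp_id] at h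
      refine GHomotopic.trans (GHomotopic.sdRealizationMap ?_) h
      rw [realizationMap_congr (hAs.comp hi.image)
        (hjs.comp (isSimplicial_of_mem fun c hc => (hmn c hc).1)) fun C hC c hc => ?_]
      · refine GHomotopic.refl (isGMap_realizationMap_subdivision _ fun c hc γ => ?_)
        rw [Function.comp_apply, isLeast_choice_smul hα hmn c hc, hjΓ _ (hc.2.1 _ (hmn c hc).1),
          Function.comp_apply]
      · rw [Function.comp_apply, Finset.image_id]
        exact hAY c (hC.2.1 c hc) _ (hmn c (hC.2.1 c hc))
    refine (h₁.postcomp hBG).trans ?_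
    refine (gHomotopic_sdRealizationMap_comp hjs (fun _ hc a ha => hjΓ a (hc.2.1 a ha))
      hBs hBΓ).trans ?_
    refine GHomotopic.trans (GHomotopic.sdRealizationMap ?_) (gHomotopic_sdRealizationMap_id
      (fun c hc => (hmx c hc).1) (isGreatest_choice_smul hα hmx))
    rw [realizationMap_congr (hBs.comp hjs.image) (isSimplicial_of_mem fun c hc => (hmx c hc).1)
      fun C hC c hc => hBj c (hC.2.1 c hc) _ (hmx c (hC.2.1 c hc))]
    exact GHomotopic.refl (isGMap_realizationMap_subdivision _ (isGreatest_choice_smul hα hmx))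
  · obtain ⟨mn, hmn⟩ := exists_isLeast_choice X
    obtain ⟨mx, hmx⟩ := exists_isGreatest_choice W
    have hmxW : ∀ c ∈ (orderComplex W).faces, mx c ∈ W := fun c hc => hc.2.1 _ (hmx c hc).1
    have h₁ : GHomotopic Γ ((realizationMap id hi).comp (sdRealizationMap B hBs))
        (realizationMap π hπs) := by
      have h := (gHomotopic_sdRealizationMap_id (fun c hc => (hmx c hc).1)
        (isGreatest_choice_smul hβ hmx)).postcomp hπG
      rw [realizationMap_comp_sdRealizationMap, ContinuousMap.comp_id] at h
      rw [realizationMap_comp_sdRealizationMap]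
      refine GHomotopic.trans (GHomotopic.sdRealizationMap ?_) h
      refine GHomotopic.symm (gHomotopic_of_le (P := (orderComplex W).faces) (Q := X)
        monotone_smul_finset (fun c hc => hπ (hmxW c hc)) (fun c hc => hYX (hB hc))
        (fun c hc d hd h => hπm (hmxW c hc) (hmxW d hd) ((hmx d hd).2
          (Finset.coe_subset.2 h (hmx c hc).1))) hBm
        (fun c hc γ => ?_) hBΓ (fun c hc => hπB c hc _ (hmx c hc)))
      rw [isGreatest_choice_smul hβ hmx c hc, hπΓ _ (hmxW c hc)]
    refine (h₁.precomp hAG).trans ?_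
    rw [realizationMap_comp_sdRealizationMap]
    refine GHomotopic.trans (GHomotopic.sdRealizationMap ?_) (gHomotopic_sdRealizationMap_id
      (fun c hc => (hmn c hc).1) (isLeast_choice_smul hα hmn))
    rw [realizationMap_congr (hπs.comp hAs) (isSimplicial_of_mem fun c hc => (hmn c hc).1)
      fun C hC c hc => hπA c (hC.2.1 c hc) _ (hmn c (hC.2.1 c hc))]
    exact GHomotopic.refl (isGMap_realizationMap_subdivision _ (isLeast_choice_smul hα hmn))

end Criteria

/-! ### Removing elements with contractible upper link -/

section Removal

open scoped Classical

theorem isGInvariant_orderComplex_of_monotone {Γ α : Type*} [Group Γ] [MulAction Γ α]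
    [PartialOrder α] (hα : ∀ γ : Γ, Monotone (γ • · : α → α)) {P : Set α}
    (hP : ∀ (γ : Γ), ∀ a ∈ P, γ • a ∈ P) : IsGInvariant Γ (orderComplex P) where
  map_mem γ s hs := by
    refine ⟨hs.1.map, ?_, ?_⟩
    · intro a ha
      obtain ⟨b, hb, rfl⟩ := Finset.mem_map.1 ha
      exact hP γ b (hs.2.1 b hb)
    · rw [Finset.coe_map]
      exact hs.2.2.image_of_map_rel (· ≤ ·) (· ≤ ·) _ fun _ _ h => hα γ h

section Lattice

variable {Γ α β : Type*} [Group Γ] [MulAction Γ α] [MulAction Γ β]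

/-- A monotone group action is by order automorphisms. -/
def smulOrderIso [Preorder β] (hβ : ∀ γ : Γ, Monotone (γ • · : β → β)) (γ : Γ) : β ≃o β where
  toEquiv := MulAction.toPerm γ
  map_rel_iff' {a b} := ⟨fun h => by simpa using hβ γ⁻¹ h, fun h => hβ γ h⟩

theorem smulOrderIso_apply [Preorder β] (hβ : ∀ γ : Γ, Monotone (γ • · : β → β)) (γ : Γ) (b : β) :
    smulOrderIso hβ γ b = γ • b := rfl

theorem inf_smul_finset [SemilatticeInf β] [OrderTop β] (hβ : ∀ γ : Γ, Monotone (γ • · : β → β))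
    {c : Finset α} {f : α → β} {γ : Γ} (h : ∀ a ∈ c, f (γ • a) = γ • f a) :
    (γ • c).inf f = γ • c.inf f := by
  rw [← smulOrderIso_apply hβ, map_finset_inf, ← Finset.image_smul, Finset.inf_image]
  exact Finset.inf_congr rfl h

theorem sup_smul_finset [SemilatticeSup β] [OrderBot β] (hβ : ∀ γ : Γ, Monotone (γ • · : β → β))
    {c : Finset α} {f : α → β} {γ : Γ} (h : ∀ a ∈ c, f (γ • a) = γ • f a) :
    (γ • c).sup f = γ • c.sup f := by
  rw [← smulOrderIso_apply hβ, map_finset_sup, ← Finset.image_smul, Finset.sup_image]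
  exact Finset.sup_congr rfl h

theorem inf_eq_of_isLeast [SemilatticeInf β] [OrderTop β] {c : Finset α} {f : α → β} {m : α}
    (hm : m ∈ c) (h : ∀ a ∈ c, f m ≤ f a) : c.inf f = f m :=
  le_antisymm (Finset.inf_le hm) (Finset.le_inf h)

theorem sup_eq_of_isGreatest [SemilatticeSup β] [OrderBot β] {c : Finset α} {f : α → β} {m : α}
    (hm : m ∈ c) (h : ∀ a ∈ c, f a ≤ f m) : c.sup f = f m :=
  le_antisymm (Finset.sup_le h) (Finset.le_sup hm)

theorem sup_finset_image {α β δ : Type*} [SemilatticeSup δ] [OrderBot δ] (c : Finset α)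
    (f : α → β) (g : β → δ) : (c.image f).sup g = c.sup (g ∘ f) :=
  Finset.sup_image c f g

end Lattice

instance {Γ α : Type*} [Group Γ] [MulAction Γ α] : MulAction Γ (WithTop α) :=
  inferInstanceAs (MulAction Γ (Option α))

section WithTop

variable {Γ α : Type*} [Group Γ] [MulAction Γ α]

theorem monotone_smul_prod_withTop [Preorder α] (hα : ∀ γ : Γ, Monotone (γ • · : α → α)) (γ : Γ) :
    Monotone (γ • · : α × WithTop α → α × WithTop α) := by
  rintro ⟨a, u⟩ ⟨b, v⟩ ⟨h₁, h₂⟩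
  refine ⟨hα γ h₁, ?_⟩
  change γ • u ≤ γ • v
  induction v with
  | top => exact le_top
  | coe v =>
    induction u with
    | top => exact absurd h₂ (by simp)
    | coe u => exact WithTop.coe_le_coe.2 (hα γ (WithTop.coe_le_coe.1 h₂))

end WithTop

variable {Γ α : Type*} [Group Γ] [MulAction Γ α] [Lattice α] [BoundedOrder α]

/-- The poset obtained from `X` by subdividing the relations between the elements outside `Y` and
those above them. -/
def cylinder (X Y : Set α) : Set (α × WithTop α) :=
  {w | (∃ y ∈ Y, w = (y, ↑y)) ∨ (∃ m ∈ X \ Y, ∃ u ∈ Y, m < u ∧ w = (m, ↑u)) ∨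
    ∃ m ∈ X \ Y, w = (m, ⊤)}

/-- The value at the vertices of the cylinder of the retraction built from `h` and `o`. -/
def cylinderValue (h : α → α → α) (o : α → α) (w : α × WithTop α) : α :=
  WithTop.recTopCoe (o w.1) (h w.1) w.2

/-- Let `Y ⊆ X` be such that distinct elements of `X \ Y` are incomparable, and that for `m` in
`X \ Y` the elements `u` of `X` above `m` are contracted by `u ≥ h m u ≤ h m u ⊔ o m ≥ o m`. Then
`Y` and `X` are equivariantly homotopy equivalent. -/
theorem gHomotopyEquivalent_of_contractible_upper [Finite α]
    (hα : ∀ γ : Γ, Monotone (γ • · : α → α)) {X Y : Set α}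
    [IsGInvariant Γ (orderComplex X)] [IsGInvariant Γ (orderComplex Y)]
    (hX : ∀ γ : Γ, ∀ a ∈ X, γ • a ∈ X) (hY : ∀ γ : Γ, ∀ a ∈ Y, γ • a ∈ Y) (hYX : Y ⊆ X)
    (hanti : ∀ m ∈ X \ Y, ∀ m' ∈ X \ Y, m ≤ m' → m = m')
    {h : α → α → α} {o : α → α}
    (hΓ : ∀ a u, ∀ γ : Γ, h (γ • a) (γ • u) = γ • h a u) (oΓ : ∀ a, ∀ γ : Γ, o (γ • a) = γ • o a)
    (hself : ∀ a, h a a = a) (hmono : ∀ a, Monotone (h a)) (hle : ∀ a u, h a u ≤ u)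
    (hge : ∀ m u, m ≤ u → m ≤ h m u) (ho : ∀ m ∈ X \ Y, m ≤ o m)
    (hhY : ∀ m ∈ X \ Y, ∀ u ∈ Y, m < u → h m u ∈ Y) (hoY : ∀ m ∈ X \ Y, o m ∈ Y)
    (hhoY : ∀ m ∈ X \ Y, ∀ u ∈ Y, m < u → h m u ⊔ o m ∈ Y) :
    GHomotopyEquivalent Γ (orderComplex Y).Realization (orderComplex X).Realization := by
  have hβ := monotone_smul_prod_withTop hα
  have hYiff : ∀ (γ : Γ) a, γ • a ∈ Y ↔ a ∈ Y := fun γ a =>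
    ⟨fun h => by simpa using hY γ⁻¹ _ h, hY γ a⟩
  have hM : ∀ (γ : Γ), ∀ m ∈ X \ Y, γ • m ∈ X \ Y := fun γ m hm =>
    ⟨hX γ m hm.1, fun h => hm.2 ((hYiff γ m).1 h)⟩
  have hlt : ∀ (γ : Γ) (a b : α), a < b → γ • a < γ • b := fun γ a b hab =>
    (smulOrderIso hα γ).strictMono hab
  have hW : ∀ γ : Γ, ∀ w ∈ cylinder X Y, γ • w ∈ cylinder X Y := by
    rintro γ _ (⟨y, hy, rfl⟩ | ⟨m, hm, u, hu, hmu, rfl⟩ | ⟨m, hm, rfl⟩)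
    · exact Or.inl ⟨γ • y, hY γ y hy, rfl⟩
    · exact Or.inr (Or.inl ⟨γ • m, hM γ m hm, γ • u, hY γ u hu, hlt γ m u hmu, rfl⟩)
    · exact Or.inr (Or.inr ⟨γ • m, hM γ m hm, rfl⟩)
  have : IsGInvariant Γ (orderComplex (cylinder X Y)) :=
    isGInvariant_orderComplex_of_monotone hβ hW
  have hbtop : ∀ a : α, cylinderValue h o (a, ⊤) = o a := fun _ => rfl
  have hbcoe : ∀ a u : α, cylinderValue h o (a, ↑u) = h a u := fun _ _ => rfl
  have hbge : ∀ w ∈ cylinder X Y, w.1 ≤ cylinderValue h o w := by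
    rintro _ (⟨y, hy, rfl⟩ | ⟨m, hm, u, hu, hmu, rfl⟩ | ⟨m, hm, rfl⟩)
    · exact hge y y le_rfl
    · exact hge m u hmu.le
    · exact ho m hm
  have hfilter : ∀ c ∈ (orderComplex X).faces, ∀ γ : Γ,
      (γ • c).filter (· ∈ Y) = γ • c.filter (· ∈ Y) := by
    intro c _ γ
    ext a
    simp only [Finset.mem_filter, Finset.mem_smul_finset]
    constructor
    · rintro ⟨⟨b, hb, rfl⟩, hbY⟩
      exact ⟨b, ⟨hb, (hYiff γ b).1 hbY⟩, rfl⟩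
    · rintro ⟨b, ⟨hb, hbY⟩, rfl⟩
      exact ⟨⟨b, hb, rfl⟩, hY γ b hbY⟩
  have hβ₂ : ∀ γ : Γ, Monotone (γ • · : WithTop α → WithTop α) := fun γ u v huv =>
    (hβ γ (show ((⊥ : α), u) ≤ (⊥, v) from ⟨le_rfl, huv⟩)).2
  refine gHomotopyEquivalent_of_factorization hα hβ (W := cylinder X Y) hYX
    (A := fun c => (c.inf id, (c.filter (· ∈ Y)).inf (fun a => (a : WithTop α))))
    ?_ ?_ ?_ (B := fun C => C.sup (cylinderValue h o)) ?_ ?_ ?_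
    (π := Prod.fst) ?_ ?_ ?_ (j := fun a => (a, (a : WithTop α))) ?_ ?_ ?_ ?_ ?_ ?_ ?_
  · intro c hc
    obtain ⟨a, ha⟩ := exists_isLeast hc
    have h₁ : c.inf id = a := inf_eq_of_isLeast (f := id) ha.1 fun b hb => ha.2 hb
    simp only [h₁]
    by_cases haY : a ∈ Y
    · left
      refine ⟨a, haY, ?_⟩
      rw [inf_eq_of_isLeast (m := a) (Finset.mem_filter.2 ⟨ha.1, haY⟩)]
      exact fun b hb => WithTop.coe_le_coe.2 (ha.2 (Finset.mem_filter.1 hb).1)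
    · right
      have ham : a ∈ X \ Y := ⟨hc.2.1 a ha.1, haY⟩
      rcases (c.filter (· ∈ Y)).eq_empty_or_nonempty with he | hne
      · right
        exact ⟨a, ham, by rw [he, Finset.inf_empty]⟩
      · left
        obtain ⟨u, hu⟩ := exists_isLeast
          (((orderComplex X).isRelLowerSet_faces hc).2 (Finset.filter_subset _ c) hne)
        obtain ⟨huc, huY⟩ := Finset.mem_filter.1 (Finset.mem_coe.1 hu.1)
        refine ⟨a, ham, u, huY, lt_of_le_of_ne (ha.2 huc) fun h => haY (h ▸ huY), ?_⟩
        rw [inf_eq_of_isLeast (m := u) hu.1]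
        exact fun b hb => WithTop.coe_le_coe.2 (hu.2 hb)
  · intro c _ d _ hcd
    exact ⟨Finset.inf_mono hcd, Finset.inf_mono (Finset.filter_subset_filter _ hcd)⟩
  · intro c hc γ
    refine Prod.ext ?_ ?_
    · exact inf_smul_finset hα fun _ _ => rfl
    · change ((γ • c).filter (· ∈ Y)).inf _ = γ • (c.filter (· ∈ Y)).inf _
      rw [hfilter c hc]
      exact inf_smul_finset hβ₂ fun _ _ => rfl
  · intro C hC
    obtain ⟨w, hw⟩ := exists_isGreatest hC
    change C.sup (cylinderValue h o) ∈ Y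
    rcases hC.2.1 w hw.1 with ⟨y, hy, rfl⟩ | ⟨m, hm, u, hu, hmu, rfl⟩ | ⟨m, hm, rfl⟩
    · rw [sup_eq_of_isGreatest hw.1, hbcoe, hself]
      · exact hy
      · intro w' hw'
        rw [hbcoe, hself]
        have hle' := hw.2 hw'
        rcases hC.2.1 w' hw' with ⟨y', hy', rfl⟩ | ⟨m', hm', u', hu', hmu', rfl⟩ | ⟨m', hm', rfl⟩
        · exact (hle _ _).trans hle'.1
        · exact (hle _ _).trans (WithTop.coe_le_coe.1 hle'.2)
        · exact absurd hle'.2 (by simp)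
    · rw [sup_eq_of_isGreatest hw.1, hbcoe]
      · exact hhY m hm u hu hmu
      · intro w' hw'
        rw [hbcoe]
        have hle' := hw.2 hw'
        rcases hC.2.1 w' hw' with ⟨y', hy', rfl⟩ | ⟨m', hm', u', hu', hmu', rfl⟩ | ⟨m', hm', rfl⟩
        · exact (hle _ _).trans (le_trans hle'.1 (hge m u hmu.le))
        · obtain rfl := hanti m' hm' m hm hle'.1
          exact hmono m' (WithTop.coe_le_coe.1 hle'.2)
        · exact absurd hle'.2 (by simp)
    · have hval : ∀ w' ∈ C, (∃ u ∈ Y, m < u ∧ w' = (m, ↑u)) ∨ cylinderValue h o w' ≤ o m := by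
        intro w' hw'
        have hle' := hw.2 hw'
        rcases hC.2.1 w' hw' with ⟨y', hy', rfl⟩ | ⟨m', hm', u', hu', hmu', rfl⟩ | ⟨m', hm', rfl⟩
        · exact Or.inr ((hle _ _).trans (le_trans hle'.1 (ho m hm)))
        · obtain rfl := hanti m' hm' m hm hle'.1
          exact Or.inl ⟨u', hu', hmu', rfl⟩
        · obtain rfl := hanti m' hm' m hm hle'.1
          exact Or.inr le_rfl
      have hoC : o m ≤ C.sup (cylinderValue h o) := Finset.le_sup (f := cylinderValue h o) hw.1
      rcases (C.filter fun w' => ∃ u ∈ Y, m < u ∧ w' = (m, ↑u)).eq_empty_or_nonempty with he | hne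
      · convert hoY m hm using 1
        refine le_antisymm (Finset.sup_le fun w' hw' => (hval w' hw').resolve_left fun hu => ?_) hoC
        exact Finset.notMem_empty w' (he ▸ Finset.mem_filter.2 ⟨hw', hu⟩)
      · obtain ⟨d, hd⟩ := exists_isGreatest (((orderComplex (cylinder X Y)).isRelLowerSet_faces
          hC).2 (Finset.filter_subset _ C) hne)
        obtain ⟨hdC, u, hu, hmu, rfl⟩ := Finset.mem_filter.1 (Finset.mem_coe.1 hd.1)
        convert hhoY m hm u hu hmu using 1
        refine le_antisymm (Finset.sup_le fun w' hw' => ?_)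
          (sup_le (Finset.le_sup (f := cylinderValue h o) hdC) hoC)
        rcases hval w' hw' with hu' | hle'
        · have hwd := hd.2 (Finset.mem_coe.2 (Finset.mem_filter.2 ⟨hw', hu'⟩))
          obtain ⟨u', -, -, rfl⟩ := hu'
          exact le_sup_of_le_left (hmono m (WithTop.coe_le_coe.1 hwd.2))
        · exact le_sup_of_le_right hle'
  · exact fun C _ D _ hCD => Finset.sup_mono hCD
  · intro C _ γ
    refine sup_smul_finset hα ?_
    rintro ⟨a, u⟩ _
    induction u with
    | top => exact oΓ a γ
    | coe u => exact hΓ a u γ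
  · rintro _ (⟨y, hy, rfl⟩ | ⟨m, hm, u, hu, hmu, rfl⟩ | ⟨m, hm, rfl⟩)
    exacts [hYX hy, hm.1, hm.1]
  · exact fun _ _ _ _ h => h.1
  · exact fun _ _ _ => rfl
  · exact fun y hy => Or.inl ⟨y, hy, rfl⟩
  · exact fun _ _ _ _ h => ⟨h, WithTop.coe_le_coe.2 h⟩
  · exact fun _ _ _ => rfl
  · intro c _ m hm
    exact inf_eq_of_isLeast (f := id) hm.1 fun b hb => hm.2 hb
  · intro c hc m hm
    have hcY : c.filter (· ∈ Y) = c := Finset.filter_true_of_mem hc.2.1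
    simp only [hcY]
    refine Prod.ext (inf_eq_of_isLeast (f := id) hm.1 fun b hb => hm.2 hb) ?_
    exact inf_eq_of_isLeast hm.1 fun b hb => WithTop.coe_le_coe.2 (hm.2 hb)
  · intro C hC w hw
    exact (hbge w (hC.2.1 w hw.1)).trans (Finset.le_sup (f := cylinderValue h o) hw.1)
  · intro c _ m hm
    refine (sup_finset_image _ _ _).trans ?_
    have hid : (cylinderValue h o ∘ fun a : α => (a, (a : WithTop α))) = id := by
      funext a
      exact hself a
    rw [hid]
    exact sup_eq_of_isGreatest (f := id) hm.1 fun b hb => hm.2 hb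

end Removal

end PreAbstractSimplicialComplex

/-! ### Conjugation of subgroups -/

section Conjugation

variable {G : Type*} [Group G]

theorem monotone_conj_smul (γ : ConjAct G) : Monotone (γ • · : Subgroup G → Subgroup G) :=
  fun _ _ h => Subgroup.pointwise_smul_le_pointwise_smul_iff.2 h

theorem conj_smul_normalizer (γ : ConjAct G) (H : Subgroup G) :
    γ • Subgroup.normalizer (H : Set G) = Subgroup.normalizer ((γ • H : Subgroup G) : Set G) :=
  Subgroup.map_equiv_normalizer_eq H (MulDistribMulAction.toMulEquiv G γ)

/-- A lax equivariant map for a monotone group action is equivariant. -/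
theorem map_smul_of_smul_le {Γ α β : Type*} [Group Γ] [MulAction Γ α] [MulAction Γ β]
    [PartialOrder β] (hβ : ∀ γ : Γ, Monotone (γ • · : β → β)) {f : α → β}
    (h : ∀ (γ : Γ) (a : α), γ • f a ≤ f (γ • a)) (γ : Γ) (a : α) : f (γ • a) = γ • f a := by
  refine le_antisymm ?_ (h γ a)
  have := hβ γ (h γ⁻¹ (γ • a))
  simpa using this

end Conjugation

/-! ### The commuting complexes and the posets of abelian subgroups -/

section Commuting

open scoped Classical

variable {G : Type*} [Group G] [Finite G]

/-- The set of nontrivial elements of a subgroup. -/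
noncomputable def nontrivialElements (H : Subgroup G) : Finset G :=
  (Set.toFinite {g : G | g ∈ H ∧ g ≠ 1}).toFinset

theorem mem_nontrivialElements {H : Subgroup G} {g : G} :
    g ∈ nontrivialElements H ↔ g ∈ H ∧ g ≠ 1 := by simp [nontrivialElements]

theorem nontrivialElements_mono : Monotone (nontrivialElements (G := G)) := fun _ _ h g hg =>
  mem_nontrivialElements.2 ((mem_nontrivialElements.1 hg).imp_left (@h g))

theorem nontrivialElements_smul (γ : ConjAct G) (H : Subgroup G) :
    nontrivialElements (γ • H) = γ • nontrivialElements H := by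
  ext g
  rw [← Finset.inv_smul_mem_iff, mem_nontrivialElements, mem_nontrivialElements,
    Subgroup.mem_pointwise_smul_iff_inv_smul_mem]
  exact and_congr_right fun _ => not_congr
    (MulDistribMulAction.toMulEquiv G γ⁻¹).map_eq_one_iff.symm

theorem closure_nontrivialElements (H : Subgroup G) :
    Subgroup.closure (nontrivialElements H : Set G) = H := by
  refine le_antisymm ((Subgroup.closure_le H).2 fun g hg => (mem_nontrivialElements.1 hg).1) ?_
  intro g hg
  by_cases h : g = 1
  · rw [h]
    exact Subgroup.one_mem _
  · exact Subgroup.subset_closure (mem_nontrivialElements.2 ⟨hg, h⟩)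

theorem nontrivialElements_mem_commutingComplex {H : Subgroup G} (hH : H ∈ abelianSubgroups G) :
    nontrivialElements H ∈ (commutingComplex G).faces := by
  refine ⟨?_, fun g hg => (mem_nontrivialElements.1 hg).2, fun g hg k hk => ?_⟩
  · obtain ⟨g, hg, hne⟩ := H.bot_or_exists_ne_one.resolve_left hH.1
    exact ⟨g, mem_nontrivialElements.2 ⟨hg, hne⟩⟩
  · exact congrArg Subtype.val (hH.2.is_comm.comm ⟨g, (mem_nontrivialElements.1 hg).1⟩
      ⟨k, (mem_nontrivialElements.1 hk).1⟩)

theorem nontrivialElements_mem_commutingComplexAt {p : ℕ} (hp : p.Prime) {H : Subgroup G}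
    (hH : H ∈ elementaryAbelianSubgroups p G) :
    nontrivialElements H ∈ (commutingComplexAt p G).faces := by
  have := Fact.mk hp
  refine ⟨nontrivialElements_mem_commutingComplex ⟨hH.1, hH.2.1⟩, fun g hg => ?_⟩
  exact orderOf_eq_prime (hH.2.2 g (mem_nontrivialElements.1 hg).1) (mem_nontrivialElements.1 hg).2

theorem isGHomotopyEquiv_closure {K : PreAbstractSimplicialComplex G}
    [IsGInvariant (ConjAct G) K] {P : Set (Subgroup G)} [IsGInvariant (ConjAct G) (orderComplex P)]
    (hK : ∀ s ∈ K.faces, ∀ g ∈ s, g ≠ 1)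
    (hF : Set.MapsTo (fun s : Finset G => Subgroup.closure (s : Set G)) K.faces P)
    (hk : Set.MapsTo nontrivialElements P K.faces) :
    ∃ f : C(K.Realization, (orderComplex P).Realization), IsGHomotopyEquiv (ConjAct G) f ∧
      ∀ y : K.subdivision.Realization, f (K.subdivisionMap y) =
        Realization.map (fun s : Finset G => Subgroup.closure (s : Set G))
          (image_closure_mem_orderComplex hF) y := by
  refine ⟨_, isGHomotopyEquiv_sdRealizationMap hF
    (fun s _ t _ h => Subgroup.closure_mono (Finset.coe_subset.2 h)) (fun s _ γ => ?_) hk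
    (fun _ _ _ _ h => nontrivialElements_mono h) (fun H _ γ => nontrivialElements_smul γ H)
    (fun H _ => closure_nontrivialElements H) (fun s hs g hg => ?_),
    fun y => sdRealizationMap_subdivisionMap _ _ y⟩
  · rw [Subgroup.smul_closure, Finset.coe_smul_finset]
  · exact mem_nontrivialElements.2 ⟨Subgroup.subset_closure hg, hK s hs g hg⟩

end Commuting

/-! ### Elementary abelian subgroups and `p`-subgroups -/

section Quillen

variable {G : Type*} [Group G] {p : ℕ}

/-- The subgroup of the elements of the center of `P` whose `p`-th power is trivial. -/
def omegaCenter (p : ℕ) (P : Subgroup G) : Subgroup G where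
  carrier := {z | z ∈ P ∧ (∀ g ∈ P, Commute z g) ∧ z ^ p = 1}
  one_mem' := ⟨P.one_mem, fun g _ => Commute.one_left g, one_pow p⟩
  mul_mem' := fun {a b} ha hb => ⟨P.mul_mem ha.1 hb.1,
    fun g hg => (ha.2.1 g hg).mul_left (hb.2.1 g hg), by
      rw [(ha.2.1 b hb.1).mul_pow, ha.2.2, hb.2.2, one_mul]⟩
  inv_mem' := fun {a} ha => ⟨P.inv_mem ha.1, fun g hg => (ha.2.1 g hg).inv_left, by
    rw [inv_pow, ha.2.2, inv_one]⟩

theorem omegaCenter_le (P : Subgroup G) : omegaCenter p P ≤ P := fun _ h => h.1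

theorem omegaCenter_smul (γ : ConjAct G) (P : Subgroup G) :
    omegaCenter p (γ • P) = γ • omegaCenter p P := by
  refine map_smul_of_smul_le (Γ := ConjAct G) monotone_conj_smul (fun γ P => ?_) γ P
  rintro _ ⟨z, hz, rfl⟩
  refine ⟨Subgroup.smul_mem_pointwise_smul z γ P hz.1, ?_, ?_⟩
  · rintro _ ⟨g, hg, rfl⟩
    exact (hz.2.1 g hg).map (MulDistribMulAction.toMonoidHom G γ)
  · change (γ • z) ^ p = 1
    rw [← smul_pow', hz.2.2, smul_one]

theorem omegaCenter_ne_bot [Finite G] (hp : p.Prime) {P : Subgroup G}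
    (hP : P ∈ nontrivialPSubgroups p G) : omegaCenter p P ≠ ⊥ := by
  have := Fact.mk hp
  have : Nontrivial P := (Subgroup.nontrivial_iff_ne_bot P).2 hP.1
  have hc : Nontrivial (Subgroup.center P) := hP.2.center_nontrivial
  have hcp : IsPGroup p (Subgroup.center P) := hP.2.to_subgroup _
  have hdvd : p ∣ Nat.card (Subgroup.center P) := by
    obtain ⟨n, hn⟩ := hcp.exists_card_eq
    have h1 := Finite.one_lt_card (α := Subgroup.center P)
    rw [hn] at h1 ⊢
    exact dvd_pow_self p fun h => by simp [h] at h1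
  obtain ⟨z, hz⟩ := exists_prime_orderOf_dvd_card' p hdvd
  intro hbot
  have hmem : ((z : P) : G) ∈ omegaCenter p P := by
    refine ⟨(z : P).2, fun g hg => ?_, ?_⟩
    · exact congrArg Subtype.val (Subgroup.mem_center_iff.1 z.2 ⟨g, hg⟩).symm
    · have : z ^ p = 1 := by rw [← hz, pow_orderOf_eq_one]
      simpa using congrArg (fun x : Subgroup.center P => ((x : P) : G)) this
  rw [hbot, Subgroup.mem_bot] at hmem
  have hz1 : z = 1 := Subtype.ext (Subtype.ext hmem)
  rw [hz1, orderOf_one] at hz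
  exact hp.one_lt.ne hz

theorem omegaCenter_of_mem {P : Subgroup G} (hP : P ∈ elementaryAbelianSubgroups p G) :
    omegaCenter p P = P := by
  refine le_antisymm (omegaCenter_le P) fun z hz => ⟨hz, fun g hg => ?_, hP.2.2 z hz⟩
  exact congrArg Subtype.val (hP.2.1.is_comm.comm ⟨z, hz⟩ ⟨g, hg⟩)

theorem mem_elementaryAbelianSubgroups_of_le_closure {T : Set G} {H : Subgroup G} (hH : H ≠ ⊥)
    (hHT : H ≤ Subgroup.closure T) (hcomm : ∀ x ∈ T, ∀ y ∈ T, Commute x y)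
    (hpow : ∀ x ∈ T, x ^ p = 1) : H ∈ elementaryAbelianSubgroups p G := by
  have hT : IsMulCommutative (Subgroup.closure T) :=
    Subgroup.isMulCommutative_closure fun a ha b hb => hcomm a ha b hb
  have hc : ∀ x ∈ Subgroup.closure T, ∀ y ∈ Subgroup.closure T, x * y = y * x :=
    fun x hx y hy => congrArg Subtype.val (hT.is_comm.comm ⟨x, hx⟩ ⟨y, hy⟩)
  refine ⟨hH, ⟨⟨fun x y => Subtype.ext (hc x (hHT x.2) y (hHT y.2))⟩⟩, fun x hx => ?_⟩
  have hx' := hHT hx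
  clear hx
  induction hx' using Subgroup.closure_induction with
  | mem x hx => exact hpow x hx
  | one => simp
  | mul x y hx hy hx' hy' =>
    have hxy : Commute x y := hc x hx y hy
    rw [hxy.mul_pow, hx', hy', one_mul]
  | inv x _ hx' => rw [inv_pow, hx', inv_one]

theorem elementaryAbelianSubgroups_subset :
    elementaryAbelianSubgroups p G ⊆ nontrivialPSubgroups p G := fun H hH =>
  ⟨hH.1, fun g => ⟨1, Subtype.ext (by simpa using hH.2.2 g g.2)⟩⟩

theorem sup_omegaCenter_mem [Finite G] (hp : p.Prime) {c : Finset (Subgroup G)}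
    (hc : c ∈ (brownComplex p G).faces) :
    c.sup (omegaCenter p) ∈ elementaryAbelianSubgroups p G := by
  obtain ⟨P₀, hP₀⟩ := hc.1
  refine mem_elementaryAbelianSubgroups_of_le_closure (T := {z | ∃ P ∈ c, z ∈ omegaCenter p P})
    ?_ (Finset.sup_le fun P hP z hz => Subgroup.subset_closure ⟨P, hP, hz⟩) ?_ ?_
  · intro h
    refine omegaCenter_ne_bot hp (hc.2.1 P₀ hP₀) (eq_bot_iff.2 ?_)
    rw [← h]
    exact Finset.le_sup (f := omegaCenter p) hP₀
  · rintro x ⟨P, hP, hx⟩ y ⟨Q, hQ, hy⟩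
    rcases hc.2.2.total hP hQ with h | h
    · exact (hy.2.1 x (h hx.1)).symm
    · exact hx.2.1 y (h hy.1)
  · rintro x ⟨P, -, hx⟩
    exact hx.2.2

theorem gHomotopyEquivalent_quillen_brown [Finite G] (hp : p.Prime) :
    GHomotopyEquivalent (ConjAct G) (quillenComplex p G).Realization
      (brownComplex p G).Realization := by
  have : IsGInvariant (ConjAct G) (orderComplex (elementaryAbelianSubgroups p G)) :=
    inferInstanceAs (IsGInvariant (ConjAct G) (quillenComplex p G))
  have : IsGInvariant (ConjAct G) (orderComplex (nontrivialPSubgroups p G)) :=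
    inferInstanceAs (IsGInvariant (ConjAct G) (brownComplex p G))
  refine gHomotopyEquivalent_of_le_max (Γ := ConjAct G) (P := elementaryAbelianSubgroups p G)
    (Q := nontrivialPSubgroups p G) monotone_conj_smul elementaryAbelianSubgroups_subset
    (E := fun c => c.sup (omegaCenter p)) (fun c hc => sup_omegaCenter_mem hp hc)
    (fun c _ d _ h => Finset.sup_mono h)
    (fun c _ γ => sup_smul_finset (Γ := ConjAct G) monotone_conj_smul fun P _ => omegaCenter_smul γ P)
    (fun c _ m hm => Finset.sup_le fun P hP => (omegaCenter_le P).trans (hm.2 hP)) ?_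
  intro c hc m hm
  refine le_antisymm (Finset.sup_le fun P hP => (omegaCenter_le P).trans (hm.2 hP)) ?_
  calc m = omegaCenter p m := (omegaCenter_of_mem (hc.2.1 m hm.1)).symm
    _ ≤ _ := Finset.le_sup (f := omegaCenter p) hm.1

end Quillen

/-! ### Radical subgroups -/

section Radical

variable {G : Type*} [Group G] {p : ℕ}

/-- The `p`-subgroups of the normalizer of `P` which are normal in it. -/
def normalPSubgroupsOfNormalizer (p : ℕ) (P : Subgroup G) : Set (Subgroup G) :=
  {Q | Q ≤ Subgroup.normalizer (P : Set G) ∧ IsPGroup p Q ∧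
    Subgroup.normalizer (P : Set G) ≤ Subgroup.normalizer (Q : Set G)}

/-- The largest normal `p`-subgroup of the normalizer of `P`. -/
def coreOfNormalizer (p : ℕ) (P : Subgroup G) : Subgroup G :=
  sSup (normalPSubgroupsOfNormalizer p P)

theorem smul_mem_normalPSubgroupsOfNormalizer (γ : ConjAct G) {P Q : Subgroup G}
    (hQ : Q ∈ normalPSubgroupsOfNormalizer p P) :
    γ • Q ∈ normalPSubgroupsOfNormalizer p (γ • P) := by
  refine ⟨?_, conj_smul_isPGroup γ hQ.2.1, ?_⟩
  · rw [← conj_smul_normalizer]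
    exact monotone_conj_smul γ hQ.1
  · rw [← conj_smul_normalizer, ← conj_smul_normalizer]
    exact monotone_conj_smul γ hQ.2.2

theorem coreOfNormalizer_smul (γ : ConjAct G) (P : Subgroup G) :
    coreOfNormalizer p (γ • P) = γ • coreOfNormalizer p P := by
  refine map_smul_of_smul_le (Γ := ConjAct G) monotone_conj_smul (fun γ P => ?_) γ P
  have h : coreOfNormalizer p P ≤ γ⁻¹ • coreOfNormalizer p (γ • P) := sSup_le fun Q hQ => by
    have hle : γ • Q ≤ coreOfNormalizer p (γ • P) :=
      le_sSup (smul_mem_normalPSubgroupsOfNormalizer γ hQ)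
    simpa using monotone_conj_smul γ⁻¹ hle
  simpa using monotone_conj_smul γ h

theorem coreOfNormalizer_mem [Finite G] (P : Subgroup G) :
    coreOfNormalizer p P ∈ normalPSubgroupsOfNormalizer p P := by
  refine SupClosed.sSup_mem ?_ (Set.toFinite _) ?_ subset_rfl
  · exact fun Q hQ R hR =>
      ⟨sup_le hQ.1 hR.1, hQ.2.1.to_sup_of_normal_right' hR.2.1 (hQ.1.trans hR.2.2),
        (le_inf hQ.2.2 hR.2.2).trans (Subgroup.normalizer_inf_normalizer_le_normalizer_sup Q R)⟩
  · refine ⟨bot_le, IsPGroup.of_bot, ?_⟩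
    rw [Subgroup.normalizer_eq_top (H := (⊥ : Subgroup G))]
    exact le_top

theorem le_coreOfNormalizer {P : Subgroup G} (hP : IsPGroup p P) : P ≤ coreOfNormalizer p P :=
  le_sSup ⟨Subgroup.le_normalizer, hP, le_rfl⟩

theorem lt_coreOfNormalizer {P : Subgroup G} (hP : P ∈ nontrivialPSubgroups p G)
    (hrad : P ∉ radicalPSubgroups p G) : P < coreOfNormalizer p P := by
  have hex : ∃ Q : Subgroup (Subgroup.normalizer (P : Set G) ⧸
      P.subgroupOf (Subgroup.normalizer (P : Set G))), Q.Normal ∧ IsPGroup p Q ∧ Q ≠ ⊥ := by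
    by_contra! h
    exact hrad ⟨hP.1, hP.2, h⟩
  obtain ⟨Q, hQn, hQp, hQ⟩ := hex
  set N := Subgroup.normalizer (P : Set G) with hN
  set π := QuotientGroup.mk' (P.subgroupOf N)
  have hRp : IsPGroup p (Q.comap π) := hQp.comap_of_ker_isPGroup π (by
    rw [QuotientGroup.ker_mk']
    exact hP.2.of_equiv (Subgroup.subgroupOfEquivOfLe Subgroup.le_normalizer).symm)
  have hmem : (Q.comap π).map N.subtype ∈ normalPSubgroupsOfNormalizer p P := by
    refine ⟨Subgroup.map_subtype_le _, hRp.map _, ?_⟩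
    have hn : (Q.comap π).Normal := hQn.comap π
    have := Subgroup.le_normalizer_map (H := Q.comap π) N.subtype
    rwa [Subgroup.normalizer_eq_top, ← MonoidHom.range_eq_map, Subgroup.range_subtype] at this
  refine lt_of_le_of_ne (le_coreOfNormalizer hP.2) fun h => hQ ?_
  have hle : (Q.comap π).map N.subtype ≤ P := (le_sSup hmem).trans h.ge
  rw [eq_bot_iff]
  intro x hx
  obtain ⟨y, rfl⟩ := QuotientGroup.mk'_surjective _ x
  have hy : (y : G) ∈ P := hle ⟨y, hx, rfl⟩
  exact Subgroup.mem_bot.2 ((QuotientGroup.eq_one_iff y).2 hy)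

theorem lt_inf_normalizer [Finite G] (hp : p.Prime) {P Q : Subgroup G} (hQ : IsPGroup p Q)
    (h : P < Q) : P < Q ⊓ Subgroup.normalizer (P : Set G) := by
  have := Fact.mk hp
  refine lt_of_le_of_ne (le_inf h.le Subgroup.le_normalizer) fun heq => ?_
  have : Group.IsNilpotent Q := hQ.isNilpotent
  have hlt : P.subgroupOf Q < ⊤ := lt_top_iff_ne_top.2 fun ht =>
    absurd (Subgroup.subgroupOf_eq_top.1 ht) (not_le_of_gt h)
  refine (Group.normalizerCondition_of_isNilpotent (G := Q) _ hlt).ne ?_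
  rw [← Subgroup.subgroupOf_normalizer_eq h.le]
  conv_lhs => rw [heq]
  exact Subgroup.inf_subgroupOf_left _ _

/-- The nontrivial `p`-subgroups which are radical or have at least `k` elements. -/
def radicalOrLargePSubgroups (p : ℕ) (G : Type*) [Group G] (k : ℕ) : Set (Subgroup G) :=
  {P | P ∈ nontrivialPSubgroups p G ∧ (P ∈ radicalPSubgroups p G ∨ k ≤ Nat.card P)}

theorem conj_smul_mem_radicalOrLargePSubgroups {k : ℕ} (γ : ConjAct G) :
    ∀ P ∈ radicalOrLargePSubgroups p G k, γ • P ∈ radicalOrLargePSubgroups p G k := fun P hP =>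
  ⟨⟨conj_smul_ne_bot γ hP.1.1, conj_smul_isPGroup γ hP.1.2⟩,
    hP.2.imp (conj_smul_mem_radicalPSubgroups γ) fun h =>
      h.trans_eq (Nat.card_congr (Subgroup.equivSMul γ P).toEquiv)⟩

instance (p k : ℕ) : IsGInvariant (ConjAct G) (orderComplex (radicalOrLargePSubgroups p G k)) :=
  isGInvariant_orderComplex conj_smul_mem_radicalOrLargePSubgroups

theorem card_lt_card_of_lt [Finite G] {P Q : Subgroup G} (h : P < Q) : Nat.card P < Nat.card Q :=
  lt_of_not_ge fun hle => h.ne (Subgroup.eq_of_le_of_card_ge h.le hle)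

theorem gHomotopyEquivalent_radicalOrLarge_succ [Finite G] (hp : p.Prime) (k : ℕ) :
    GHomotopyEquivalent (ConjAct G)
      (orderComplex (radicalOrLargePSubgroups p G (k + 1))).Realization
      (orderComplex (radicalOrLargePSubgroups p G k)).Realization := by
  have hM : ∀ P ∈ radicalOrLargePSubgroups p G k \ radicalOrLargePSubgroups p G (k + 1),
      P ∉ radicalPSubgroups p G ∧ Nat.card P = k := by
    rintro P ⟨⟨hP, hPk⟩, hP'⟩
    have hrad : P ∉ radicalPSubgroups p G := fun h => hP' ⟨hP, Or.inl h⟩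
    refine ⟨hrad, le_antisymm ?_ (hPk.resolve_left hrad)⟩
    by_contra! h
    exact hP' ⟨hP, Or.inr h⟩
  have hmem : ∀ P ∈ radicalOrLargePSubgroups p G k \ radicalOrLargePSubgroups p G (k + 1),
      ∀ Q : Subgroup G, P < Q → IsPGroup p Q → Q ∈ radicalOrLargePSubgroups p G (k + 1) :=
    fun P hP Q hPQ hQ => ⟨⟨(bot_le.trans_lt hPQ).ne', hQ⟩, Or.inr (by
      rw [← (hM P hP).2]
      exact card_lt_card_of_lt hPQ)⟩
  have hcore : ∀ P ∈ radicalOrLargePSubgroups p G k \ radicalOrLargePSubgroups p G (k + 1),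
      P < coreOfNormalizer p P := fun P hP => lt_coreOfNormalizer hP.1.1 (hM P hP).1
  refine gHomotopyEquivalent_of_contractible_upper (Γ := ConjAct G) monotone_conj_smul
    conj_smul_mem_radicalOrLargePSubgroups conj_smul_mem_radicalOrLargePSubgroups
    (fun P hP => ⟨hP.1, hP.2.imp_right fun h => (Nat.le_succ k).trans h⟩) ?_
    (h := fun P Q => Q ⊓ Subgroup.normalizer (P : Set G)) (o := coreOfNormalizer p)
    ?_ (fun P γ => coreOfNormalizer_smul γ P) (fun P => inf_eq_left.2 Subgroup.le_normalizer)
    (fun P Q R h => inf_le_inf_right _ h) (fun P Q => inf_le_left)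
    (fun P Q h => le_inf h Subgroup.le_normalizer) (fun P hP => (hcore P hP).le) ?_ ?_ ?_
  · intro P hP Q hQ h
    exact Subgroup.eq_of_le_of_card_ge h ((hM Q hQ).2.trans (hM P hP).2.symm).le
  · intro P Q γ
    rw [← conj_smul_normalizer, Subgroup.smul_inf]
  · intro P hP Q hQ h
    exact hmem P hP _ (lt_inf_normalizer hp hQ.1.2 h) (hQ.1.2.to_le inf_le_left)
  · intro P hP
    exact hmem P hP _ (hcore P hP) (coreOfNormalizer_mem P).2.1
  · intro P hP Q hQ h
    refine hmem P hP _ ((hcore P hP).trans_le le_sup_right) ?_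
    exact (hQ.1.2.to_le inf_le_left).to_sup_of_normal_right' (coreOfNormalizer_mem P).2.1
      (inf_le_right.trans (coreOfNormalizer_mem P).2.2)

theorem gHomotopyEquivalent_radicalOrLarge_zero [Finite G] (hp : p.Prime) (k : ℕ) :
    GHomotopyEquivalent (ConjAct G)
      (orderComplex (radicalOrLargePSubgroups p G k)).Realization
      (orderComplex (radicalOrLargePSubgroups p G 0)).Realization := by
  induction k with
  | zero => exact .refl
  | succ k ih => exact (gHomotopyEquivalent_radicalOrLarge_succ hp k).trans ih

theorem gHomotopyEquivalent_orderComplex_of_eq [Finite G] {P Q : Set (Subgroup G)}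
    [IsGInvariant (ConjAct G) (orderComplex P)] [IsGInvariant (ConjAct G) (orderComplex Q)]
    (h : P = Q) : GHomotopyEquivalent (ConjAct G) (orderComplex P).Realization
      (orderComplex Q).Realization := by
  subst h
  exact .refl

theorem gHomotopyEquivalent_radical_brown [Finite G] (hp : p.Prime) :
    GHomotopyEquivalent (ConjAct G) (radicalComplex p G).Realization
      (brownComplex p G).Realization := by
  have : IsGInvariant (ConjAct G) (orderComplex (radicalPSubgroups p G)) :=
    inferInstanceAs (IsGInvariant (ConjAct G) (radicalComplex p G))
  have : IsGInvariant (ConjAct G) (orderComplex (nontrivialPSubgroups p G)) :=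
    inferInstanceAs (IsGInvariant (ConjAct G) (brownComplex p G))
  have h₀ : radicalOrLargePSubgroups p G 0 = nontrivialPSubgroups p G := by
    ext P
    exact ⟨fun h => h.1, fun h => ⟨h, Or.inr (Nat.zero_le _)⟩⟩
  have h₁ : radicalPSubgroups p G = radicalOrLargePSubgroups p G (Nat.card G + 1) := by
    ext P
    refine ⟨fun h => ⟨⟨h.1, h.2.1⟩, Or.inl h⟩, fun h => h.2.resolve_right fun hk => ?_⟩
    exact absurd P.card_le_card_group (not_le_of_gt hk)
  exact (gHomotopyEquivalent_orderComplex_of_eq h₁).trans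
    ((gHomotopyEquivalent_radicalOrLarge_zero hp _).trans
      (gHomotopyEquivalent_orderComplex_of_eq h₀))

end Radical

theorem mainTheorem7 {G : Type*} [Group G] [Finite G] :
    (∃ f : C((commutingComplex G).Realization, (abelianComplex G).Realization),
      IsGHomotopyEquiv (ConjAct G) f ∧
      ∀ y : (commutingComplex G).subdivision.Realization,
        f ((commutingComplex G).subdivisionMap y) = generatedSubgroupMap G y) ∧
    ∀ p : ℕ, p.Prime →
      (∃ f : C((commutingComplexAt p G).Realization, (quillenComplex p G).Realization),
        IsGHomotopyEquiv (ConjAct G) f ∧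
        ∀ y : (commutingComplexAt p G).subdivision.Realization,
          f ((commutingComplexAt p G).subdivisionMap y) = generatedSubgroupMapAt p G y) ∧
      GHomotopyEquivalent (ConjAct G)
        (commutingComplexAt p G).Realization (brownComplex p G).Realization ∧
      GHomotopyEquivalent (ConjAct G)
        (commutingComplexAt p G).Realization (radicalComplex p G).Realization := by
  have hA : IsGInvariant (ConjAct G) (orderComplex (abelianSubgroups G)) :=
    inferInstanceAs (IsGInvariant (ConjAct G) (abelianComplex G))
  refine ⟨isGHomotopyEquiv_closure (K := commutingComplex G) (fun s hs => hs.2.1)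
    (fun _ hs => closure_mem_abelianSubgroups hs)
    (fun _ hH => nontrivialElements_mem_commutingComplex hH), fun p hp => ?_⟩
  have hE : IsGInvariant (ConjAct G) (orderComplex (elementaryAbelianSubgroups p G)) :=
    inferInstanceAs (IsGInvariant (ConjAct G) (quillenComplex p G))
  have h := isGHomotopyEquiv_closure (K := commutingComplexAt p G) (fun s hs => hs.1.2.1)
    (fun _ hs => closure_mem_elementaryAbelianSubgroups hs)
    (fun _ hH => nontrivialElements_mem_commutingComplexAt hp hH)
  have hS : GHomotopyEquivalent (ConjAct G)
      (commutingComplexAt p G).Realization (brownComplex p G).Realization :=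
    GHomotopyEquivalent.trans (h.imp fun _ hf => hf.1) (gHomotopyEquivalent_quillen_brown hp)
  exact ⟨h, hS, hS.trans (gHomotopyEquivalent_radical_brown hp).symm⟩
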